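/- Let $X \subseteq \mathbb{P}^n$ be a non-empty irreducible complex projective variety of dimension $k$ and let $0 \le i \le k$. Assume that $X \neq \mathbb{P}^n$ or $i = k$. Write $\mathrm{Reg}(X)$ for the set of smooth points of $X$ and $T_xX \subseteq \mathbb{P}^n$ for the embedded tangent space at $x \in \mathrm{Reg}(X)$. The $i$-th coisotropic variety of $X$ is the Zariski closure $$\mathrm{CH}_i(X) := \overline{\{ L \mid \exists\, x \in \mathrm{Reg}(X) \cap L : \dim (L \cap T_xX) \ge i \}} \subseteq \mathrm{Gr}(n-k+i-1, \mathbb{P}^n)$$ in the Grassmannian of $(n-k+i-1)$-dimensional projective subspaces of $\mathbb{P}^n$. Let $S(k-i+1,n+1)$ be the set of complex $(k-i+1)\times(n+1)$-matrices of full rank, and let $$p : S(k-i+1,n+1) \to \mathrm{Gr}(n-k+i-1,\mathbb{P}^n), \qquad A \mapsto \mathbb{P}(\ker A).$$ Consider $\mathbb{P}^{k-i}\times X$ as a subvariety of $\mathbb{P}(\mathbb{C}^{(k-i+1)\times(n+1)})$ via the Segre embedding $(y,x) \mapsto (y_a x_b)_{a,b}$. For a projective variety $Z$, its dual $Z^\vee$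 is the Zariski closure, in the dual projective space, of the set of hyperplanes that contain the embedded tangent space of $Z$ at some smooth point of $Z$; and $((\mathbb{P}^{k-i}\times X)^\vee)^\ast \subseteq \mathbb{P}(\mathbb{C}^{(k-i+1)\times(n+1)})$ denotes the set of all points $A$ such that the hyperplane $\{ M \mid \sum_{a,b} A_{ab} M_{ab} = 0\}$ belongs to $(\mathbb{P}^{k-i}\times X)^\vee$. Then $$\overline{p^{-1}(\mathrm{CH}_i(X))} = \left((\mathbb{P}^{k-i}\times X)^\vee\right)^\ast,$$ where the closure on the left-hand side is the Zariski closure, in $\mathbb{P}(\mathbb{C}^{(k-i+1)\times(n+1)})$, of the set of points represented by the matrices in $p^{-1}(\mathrm{CH}_i(X))$. -/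

import Mathlib

open scoped LinearAlgebra.Projectivization

noncomputable section

namespace CayleyTrick

section Projective

variable {ι V : Type} [AddCommGroup V] [Module ℂ V]

/-- The vanishing ideal `I(X)` of a set `X` of points of `ℙ(V)`, in the polynomial ring in the
homogeneous coordinates on `V` given by the basis `b`. A polynomial lies in it if and only if it
vanishes at all representatives of all points of `X` (equivalently, if and only if all its
homogeneous components vanish on `X`). -/
def vanishingIdeal [Finite ι] (b : Module.Basis ι ℂ V) (X : Set (ℙ ℂ V)) :
    Ideal (MvPolynomial ι ℂ) where
  carrier := {f | ∀ (v : V) (hv : v ≠ 0), Projectivization.mk ℂ v hv ∈ X →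
    MvPolynomial.eval (b.equivFun v) f = 0}
  zero_mem' := fun v hv _ => by simp
  add_mem' := fun {f g} hf hg v hv hx => by rw [map_add, hf v hv hx, hg v hv hx, add_zero]
  smul_mem' := fun c f hf v hv hx => by rw [smul_eq_mul, map_mul, hf v hv hx, mul_zero]

/-- The Zariski closure of a set of points of `ℙ(V)`: the common zeros of its vanishing ideal. -/
def zariskiClosure [Finite ι] (b : Module.Basis ι ℂ V) (X : Set (ℙ ℂ V)) : Set (ℙ ℂ V) :=
  {p | ∀ f ∈ vanishingIdeal b X, ∀ (v : V) (hv : v ≠ 0), Projectivization.mk ℂ v hv = p →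
    MvPolynomial.eval (b.equivFun v) f = 0}

/-- Zariski closed subsets of `ℙ(V)`. -/
def IsZariskiClosed [Finite ι] (b : Module.Basis ι ℂ V) (X : Set (ℙ ℂ V)) : Prop :=
  zariskiClosure b X = X

/-- Non-empty irreducible projective varieties in `ℙ(V)`. -/
structure IsIrreducibleVariety [Finite ι] (b : Module.Basis ι ℂ V) (X : Set (ℙ ℂ V)) : Prop where
  nonempty : X.Nonempty
  isClosed : IsZariskiClosed b X
  irreducible : ∀ Y Z : Set (ℙ ℂ V), IsZariskiClosed b Y → IsZariskiClosed b Z →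
    X ⊆ Y ∪ Z → X ⊆ Y ∨ X ⊆ Z

/-- `X` has dimension `k`: its homogeneous coordinate ring, which is the coordinate ring of the
affine cone over `X`, has Krull dimension `k + 1`. -/
def HasDim [Finite ι] (b : Module.Basis ι ℂ V) (X : Set (ℙ ℂ V)) (k : ℕ) : Prop :=
  ringKrullDim (MvPolynomial ι ℂ ⧸ vanishingIdeal b X) = ((k + 1 : ℕ) : WithBot ℕ∞)

/-- The linear subspace of `V` whose projectivization is the embedded tangent space `T_x X`. -/
def tangentSpace [Fintype ι] (b : Module.Basis ι ℂ V) (X : Set (ℙ ℂ V)) (x : ℙ ℂ V) :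
    Submodule ℂ V where
  carrier := {y | ∀ f ∈ vanishingIdeal b X,
    ∑ j, MvPolynomial.eval (b.equivFun x.rep) (MvPolynomial.pderiv j f) * b.equivFun y j = 0}
  zero_mem' := fun f _ => by simp
  add_mem' := fun {y z} hy hz f hf => by
    simp only [map_add, Pi.add_apply, mul_add, Finset.sum_add_distrib]
    rw [hy f hf, hz f hf, add_zero]
  smul_mem' := fun c y hy f hf => by
    have h := congrArg (fun t => c * t) (hy f hf)
    simp only [Finset.mul_sum, mul_zero] at h
    rw [← h]
    refine Finset.sum_congr rfl fun j _ => ?_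
    simp only [map_smul, Pi.smul_apply, smul_eq_mul]
    ring

/-- `Reg(X)`, for an irreducible variety `X`: the points at which the projective dimension of the
embedded tangent space equals the dimension of `X`. -/
def Reg [Fintype ι] (b : Module.Basis ι ℂ V) (X : Set (ℙ ℂ V)) : Set (ℙ ℂ V) :=
  {x | x ∈ X ∧ ∃ d : ℕ, HasDim b X d ∧ Module.finrank ℂ (tangentSpace b X x) = d + 1}

/-- The projectively dual variety `X^∨`, in the projectivization of the dual space of `V`, whose
points are the hyperplanes of `ℙ(V)`: the Zariski closure of the set of hyperplanes that contain
`T_x X` for some smooth point `x` of `X`. -/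
def dualVariety [Fintype ι] [DecidableEq ι] (b : Module.Basis ι ℂ V) (X : Set (ℙ ℂ V)) :
    Set (ℙ ℂ (Module.Dual ℂ V)) :=
  zariskiClosure b.dualBasis
    {H | ∃ x ∈ Reg b X, tangentSpace b X x ≤ LinearMap.ker H.rep}

/-- The identification of `ℙ(V)` with the dual projective space that sends the point with
homogeneous coordinates `y` to the hyperplane `∑ y_j x_j = 0`. -/
def hyperplaneOfPoint [Finite ι] [DecidableEq ι] (b : Module.Basis ι ℂ V) :
    ℙ ℂ V → ℙ ℂ (Module.Dual ℂ V) :=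
  Projectivization.map b.toDual b.toDual_injective

/-- `Σ^*` for a set `Σ` of hyperplanes of `ℙ(V)`: the points of `ℙ(V)` that are identified with
a hyperplane in `Σ`. -/
def dualStar [Finite ι] [DecidableEq ι] (b : Module.Basis ι ℂ V) (S : Set (ℙ ℂ (Module.Dual ℂ V))) :
    Set (ℙ ℂ V) :=
  hyperplaneOfPoint b ⁻¹' S

end Projective

section Matrices

/-- Homogeneous coordinates on `ℙ(ℂ^N)`. -/
abbrev coordBasis (N : ℕ) : Module.Basis (Fin N) ℂ (Fin N → ℂ) := Pi.basisFun ℂ (Fin N)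

/-- Homogeneous coordinates on `ℙ(ℂ^(m × N))`: the entries of a matrix. -/
abbrev matBasis (m N : ℕ) : Module.Basis (Fin m × Fin N) ℂ (Matrix (Fin m) (Fin N) ℂ) :=
  Matrix.stdBasis ℂ (Fin m) (Fin N)

theorem vecMulVec_rep_ne_zero {m N : ℕ} (y : ℙ ℂ (Fin m → ℂ)) (x : ℙ ℂ (Fin N → ℂ)) :
    Matrix.vecMulVec y.rep x.rep ≠ 0 := by
  intro h
  obtain ⟨a, ha⟩ := Function.ne_iff.1 y.rep_nonzero
  obtain ⟨c, hc⟩ := Function.ne_iff.1 x.rep_nonzero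
  exact mul_ne_zero ha hc (congrFun (congrFun h a) c)

/-- The Segre map `(y, x) ↦ y ⊗ x = (y_a x_c)`. -/
def segre {m N : ℕ} (y : ℙ ℂ (Fin m → ℂ)) (x : ℙ ℂ (Fin N → ℂ)) :
    ℙ ℂ (Matrix (Fin m) (Fin N) ℂ) :=
  Projectivization.mk ℂ (Matrix.vecMulVec y.rep x.rep) (vecMulVec_rep_ne_zero y x)

/-- The Segre product `Y × X`, as a subset of the projective space of matrices. -/
def segreProduct {m N : ℕ} (Y : Set (ℙ ℂ (Fin m → ℂ))) (X : Set (ℙ ℂ (Fin N → ℂ))) :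
    Set (ℙ ℂ (Matrix (Fin m) (Fin N) ℂ)) :=
  Set.image2 segre Y X

/-- The Grassmannian of linear subspaces of codimension `m` in `ℂ^N`. For `N = n + 1` this is
`Gr(l, ℙ^n)` with `l = n - m`. -/
def Gr (m N : ℕ) : Type :=
  {L : Submodule ℂ (Fin N → ℂ) // Module.finrank ℂ L + m = N}

/-- The Stiefel variety `S(m, N)` of complex `m × N` matrices of full rank `m`. -/
def Stiefel (m N : ℕ) : Type :=
  {A : Matrix (Fin m) (Fin N) ℂ // A.rank = m}

/-- The projection `p : A ↦ ker A` from the Stiefel variety to the Grassmannian. -/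
def stiefelKer {m N : ℕ} (A : Stiefel m N) : Gr m N :=
  ⟨LinearMap.ker A.1.mulVecLin, by
    have h := LinearMap.finrank_range_add_finrank_ker A.1.mulVecLin
    have hA : Module.finrank ℂ (LinearMap.range A.1.mulVecLin) = m := A.2
    rw [hA, Module.finrank_fin_fun] at h
    omega⟩

/-- The primal Plücker coordinates of `ker A`: the maximal minors of `A`. -/
def plucker {m N : ℕ} (A : Stiefel m N) : (Fin m ↪o Fin N) → ℂ :=
  fun s => (A.1.submatrix id s).det

/-- The Zariski closure in the Grassmannian, in the sense of the Plücker embedding: the points at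
which all those polynomials in the Plücker coordinates vanish that vanish on `S`. -/
def grClosure {m N : ℕ} (S : Set (Gr m N)) : Set (Gr m N) :=
  {L | ∀ P : MvPolynomial (Fin m ↪o Fin N) ℂ,
    (∀ A : Stiefel m N, stiefelKer A ∈ S → MvPolynomial.eval (plucker A) P = 0) →
    ∀ A : Stiefel m N, stiefelKer A = L → MvPolynomial.eval (plucker A) P = 0}

/-- The `i`-th coisotropic variety `CH_i(X)` of a `k`-dimensional variety `X` in `ℙ^n`, for
`i ≤ k`. It lies in `Gr(n - k + i - 1, ℙ^n)`, whose members are the subspaces of codimension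
`k - i + 1`. The condition `dim (L ∩ T_x X) ≥ i` reads `≥ i + 1` for linear subspaces. -/
def CH {n : ℕ} (X : Set (ℙ ℂ (Fin (n + 1) → ℂ))) (k i : ℕ) : Set (Gr (k - i + 1) (n + 1)) :=
  grClosure {L | ∃ x ∈ Reg (coordBasis (n + 1)) X, x.submodule ≤ L.1 ∧
    i + 1 ≤ Module.finrank ℂ ↥(L.1 ⊓ tangentSpace (coordBasis (n + 1)) X x)}

/-- A set of full rank matrices, as a subset of the projective space of matrices. -/
def matrixPoints {m N : ℕ} (T : Set (Stiefel m N)) : Set (ℙ ℂ (Matrix (Fin m) (Fin N) ℂ)) :=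
  {P | ∃ A ∈ T, ∃ hA : A.1 ≠ 0, P = Projectivization.mk ℂ A.1 hA}

end Matrices

end CayleyTrick

end

/-! Write m = k - i. The embedded tangent space of ℙ^m × X at (y, x) is ℂ^(m+1) ⊗ x + y ⊗ T_xX
(`mem_tangentSpace_segreProduct`). A matrix A annihilates it exactly when Ax = 0 and yᵀAv = 0 for
all v in T_xX. For given x, such a y ≠ 0 exists if and only if A restricted to T_xX is not
surjective onto ℂ^(m+1). At a smooth point dim T_xX = k + 1, so by rank-nullity this means that ker
A meets T_xX in linear dimension at least i + 1. Hence, among matrices of full rank, tangency to ℙ^m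
× X and the coisotropic condition on ker A are the same (`mk_mem_dualStar_segreProduct_iff`,
`stiefelKer_mem_iff`).

Both sides are Zariski closures, so it remains to compare vanishing ideals, and two gaps must be
closed. One is the closure taken in the Grassmannian: it adds no matrix on which a polynomial of the
ideal fails to vanish, because a polynomial in matrix entries can be rewritten in Plücker
coordinates near a given kernel (`eval_eq_zero_of_mem_grClosure`). The other is the tangent
hyperplanes given by matrices of lower rank. For fixed x and y the admissible matrices form a linear
space, and if it contains one matrix of full rank, then full rank is generic in it
(`eval_eq_zero_of_forall_rank_eq`). Such a matrix exists if T_xX is a proper subspace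
(`exists_rank_eq_of_ne_top`), or if i = k, where matrices have a single row.

Matching smooth points of ℙ^m × X with those of X also requires the dimension of the product, which
comes from transcendence degrees (`hasDim_segreProduct`). -/

namespace CayleyTrick

/-! ### Krull dimension and transcendence degree -/

section KrullDimension

/-- An injective integral extension preserves the Krull dimension. -/
theorem ringKrullDim_eq_of_isIntegral {R S : Type*} [CommRing R] [CommRing S] [Algebra R S]
    [Algebra.IsIntegral R S] [FaithfulSMul R S] : ringKrullDim R = ringKrullDim S := by
  apply le_antisymm
  · refine iSup_le fun l => ?_
    obtain ⟨Q, -, hQ, hQl⟩ := Ideal.exists_ideal_over_prime_of_isIntegral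
      l.head.asIdeal (⊥ : Ideal S) (by
        rw [← RingHom.ker_eq_comap_bot, (RingHom.injective_iff_ker_eq_bot _).1
          (FaithfulSMul.algebraMap_injective R S)]
        exact bot_le)
    have : Q.LiesOver l.head.asIdeal := ⟨hQl.symm⟩
    obtain ⟨L, hL, -⟩ := Ideal.exists_ltSeries_of_hasGoingUp l Q
    rw [← hL]
    exact le_iSup (fun L : LTSeries (PrimeSpectrum S) => ((L.length : ℕ∞) : WithBot ℕ∞)) L
  · exact Order.krullDim_le_of_strictMono (PrimeSpectrum.comap (algebraMap R S))
      fun I J h => Ideal.IsIntegral.comap_lt_comap (I := I.asIdeal) (J := J.asIdeal) h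

/-- The Krull dimension of a finitely generated domain over a field is its transcendence degree. -/
theorem exists_ringKrullDim_eq_trdeg_eq (K A : Type*) [Field K] [CommRing A] [IsDomain A]
    [Algebra K A] [Algebra.FiniteType K A] :
    ∃ d : ℕ, ringKrullDim A = d ∧ Algebra.trdeg K A = d := by
  -- Noether normalization: both invariants are those of a polynomial ring in `s` variables.
  obtain ⟨s, g, hg, hint⟩ := exists_integral_inj_algHom_of_fg K A
  algebraize [g.toRingHom]
  have : Algebra.IsIntegral (MvPolynomial (Fin s) K) A := ⟨hint⟩
  have : FaithfulSMul (MvPolynomial (Fin s) K) A :=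
    (faithfulSMul_iff_algebraMap_injective _ _).2 hg
  have : IsScalarTower K (MvPolynomial (Fin s) K) A :=
    IsScalarTower.of_algebraMap_eq fun c => (g.commutes c).symm
  refine ⟨s, ?_, ?_⟩
  · rw [← ringKrullDim_eq_of_isIntegral (R := MvPolynomial (Fin s) K),
      MvPolynomial.ringKrullDim_of_isNoetherianRing, ringKrullDim_eq_zero_of_field]
    simp
  · have h := lift_trdeg_add_eq K (MvPolynomial (Fin s) K) A
    rw [trdeg_eq_zero (R := MvPolynomial (Fin s) K) (A := A)] at h
    simpa using h.symm

/-- An injective algebraic extension of finitely generated domains over a field preserves the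
Krull dimension. -/
theorem ringKrullDim_eq_of_isAlgebraic (K : Type*) {A B : Type*} [Field K] [CommRing A]
    [CommRing B] [IsDomain A] [IsDomain B] [Algebra K A] [Algebra K B] [Algebra A B]
    [IsScalarTower K A B] [Algebra.FiniteType K A] [Algebra.FiniteType K B] [FaithfulSMul A B]
    [Algebra.IsAlgebraic A B] : ringKrullDim A = ringKrullDim B := by
  obtain ⟨d, hd, hd'⟩ := exists_ringKrullDim_eq_trdeg_eq K A
  obtain ⟨e, he, he'⟩ := exists_ringKrullDim_eq_trdeg_eq K B
  have h := lift_trdeg_add_eq K A B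
  rw [trdeg_eq_zero (R := A) (A := B), hd', he'] at h
  have h' : d = e := by simpa using h
  rw [hd, he, h']

end KrullDimension

/-! ### Polynomials on lines and directional derivatives -/

section DirectionalDerivative

variable {ι κ : Type*}

/-- The restriction of a polynomial to the line `t ↦ u + t v`. -/
noncomputable def lineRestriction (u v : ι → ℂ) : MvPolynomial ι ℂ →ₐ[ℂ] Polynomial ℂ :=
  MvPolynomial.aeval fun j => Polynomial.C (u j) + Polynomial.X * Polynomial.C (v j)

theorem eval_lineRestriction (u v : ι → ℂ) (f : MvPolynomial ι ℂ) (t : ℂ) :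
    (lineRestriction u v f).eval t = MvPolynomial.eval (u + t • v) f := by
  have h : ((Polynomial.aeval t).comp (lineRestriction u v) : MvPolynomial ι ℂ →ₐ[ℂ] ℂ) =
      MvPolynomial.aeval (u + t • v) := by
    ext j
    simp [lineRestriction, mul_comm t, -Polynomial.X_mul_C]
  simpa [Polynomial.coe_aeval_eq_eval, MvPolynomial.coe_aeval_eq_eval] using
    DFunLike.congr_fun h f

/-- If `f` vanishes wherever `g` does not on a line on which `g` is not identically zero, then `f`
vanishes on that line. -/
theorem eval_eq_zero_of_line {u v : ι → ℂ} {f g : MvPolynomial ι ℂ}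
    (h : ∀ t : ℂ, MvPolynomial.eval (u + t • v) g ≠ 0 → MvPolynomial.eval (u + t • v) f = 0)
    {t₀ : ℂ} (ht₀ : MvPolynomial.eval (u + t₀ • v) g ≠ 0) (t : ℂ) :
    MvPolynomial.eval (u + t • v) f = 0 := by
  -- The univariate polynomial ring is a domain, so a vanishing product forces one restriction to
  -- vanish.
  have hmul : lineRestriction u v f * lineRestriction u v g = 0 := by
    refine Polynomial.funext fun t => ?_
    rw [Polynomial.eval_mul, eval_lineRestriction, eval_lineRestriction, Polynomial.eval_zero]
    by_cases hg : MvPolynomial.eval (u + t • v) g = 0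
    · rw [hg, mul_zero]
    · rw [h t hg, zero_mul]
  rcases mul_eq_zero.1 hmul with h0 | h0
  · rw [← eval_lineRestriction, h0, Polynomial.eval_zero]
  · rw [← eval_lineRestriction, h0, Polynomial.eval_zero] at ht₀
    exact absurd rfl ht₀

/-- A polynomial that vanishes at all but finitely many points of a line vanishes on it. -/
theorem eval_eq_zero_of_line_of_finite {u v : ι → ℂ} {f : MvPolynomial ι ℂ} {s : Set ℂ}
    (hs : s.Finite) (h : ∀ t ∉ s, MvPolynomial.eval (u + t • v) f = 0) (t : ℂ) :
    MvPolynomial.eval (u + t • v) f = 0 := by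
  have h0 : lineRestriction u v f = 0 := by
    refine Polynomial.eq_zero_of_infinite_isRoot _ (hs.infinite_compl.mono fun t ht => ?_)
    rw [Set.mem_ofPred_eq, Polynomial.IsRoot, eval_lineRestriction, h t ht]
  rw [← eval_lineRestriction, h0, Polynomial.eval_zero]

variable [Fintype ι] [Fintype κ]

/-- The derivative of `f` at the point `u` in the direction `v`. -/
noncomputable def dirDeriv (f : MvPolynomial ι ℂ) (u v : ι → ℂ) : ℂ :=
  ∑ j, MvPolynomial.eval u (MvPolynomial.pderiv j f) * v j

@[simp]
theorem dirDeriv_C (c : ℂ) (u v : ι → ℂ) : dirDeriv (MvPolynomial.C c) u v = 0 := by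
  simp [dirDeriv]

@[simp]
theorem dirDeriv_X (j : ι) (u v : ι → ℂ) : dirDeriv (MvPolynomial.X j) u v = v j := by
  classical
  simp [dirDeriv, MvPolynomial.pderiv_X, Pi.single_apply, apply_ite, Finset.sum_ite_eq]

@[simp]
theorem dirDeriv_add (f g : MvPolynomial ι ℂ) (u v : ι → ℂ) :
    dirDeriv (f + g) u v = dirDeriv f u v + dirDeriv g u v := by
  simp [dirDeriv, add_mul, Finset.sum_add_distrib]

@[simp]
theorem dirDeriv_sub (f g : MvPolynomial ι ℂ) (u v : ι → ℂ) :
    dirDeriv (f - g) u v = dirDeriv f u v - dirDeriv g u v := by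
  simp [dirDeriv, sub_mul, Finset.sum_sub_distrib]

@[simp]
theorem dirDeriv_mul (f g : MvPolynomial ι ℂ) (u v : ι → ℂ) :
    dirDeriv (f * g) u v =
      MvPolynomial.eval u f * dirDeriv g u v + dirDeriv f u v * MvPolynomial.eval u g := by
  simp only [dirDeriv, MvPolynomial.pderiv_mul, map_add, map_mul, Finset.mul_sum, Finset.sum_mul,
    ← Finset.sum_add_distrib]
  exact Finset.sum_congr rfl fun j _ => by ring

theorem dirDeriv_smul_right (f : MvPolynomial ι ℂ) (u v : ι → ℂ) (c : ℂ) :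
    dirDeriv f u (c • v) = c * dirDeriv f u v := by
  simp only [dirDeriv, Finset.mul_sum, Pi.smul_apply, smul_eq_mul]
  exact Finset.sum_congr rfl fun j _ => by ring

/-- The chain rule. -/
theorem dirDeriv_bind₁ (h : ι → MvPolynomial κ ℂ) (f : MvPolynomial ι ℂ) (u v : κ → ℂ) :
    dirDeriv (MvPolynomial.bind₁ h f) u v =
      dirDeriv f (fun j => MvPolynomial.eval u (h j)) fun j => dirDeriv (h j) u v := by
  induction f using MvPolynomial.induction_on with
  | C a => simp
  | add p q hp hq => simp [hp, hq]
  | mul_X p j hp =>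
    have h' : MvPolynomial.eval u (MvPolynomial.bind₁ h p) =
        MvPolynomial.eval (fun j => MvPolynomial.eval u (h j)) p :=
      MvPolynomial.eval₂Hom_bind₁ _ _ _ _
    rw [map_mul, dirDeriv_mul, hp, h', MvPolynomial.bind₁_X_right, dirDeriv_mul, dirDeriv_X,
      MvPolynomial.eval_X]

theorem derivative_lineRestriction (u v : ι → ℂ) (f : MvPolynomial ι ℂ) :
    (Polynomial.derivative (lineRestriction u v f)).eval 0 = dirDeriv f u v := by
  induction f using MvPolynomial.induction_on with
  | C a => simp [lineRestriction]
  | add p q hp hq => simp [hp, hq]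
  | mul_X p j hp =>
    have hX : lineRestriction u v (MvPolynomial.X j) =
        Polynomial.C (u j) + Polynomial.X * Polynomial.C (v j) := MvPolynomial.aeval_X _ _
    rw [map_mul, Polynomial.derivative_mul, Polynomial.eval_add, Polynomial.eval_mul,
      Polynomial.eval_mul, hp, eval_lineRestriction u v p, zero_smul, add_zero, dirDeriv_mul, hX]
    simp [add_comm]

/-- If `f` vanishes on the line through `u` in the direction `v`, up to finitely many points, then
its derivative at `u` in this direction is zero. -/
theorem dirDeriv_eq_zero_of_line {u v : ι → ℂ} {f : MvPolynomial ι ℂ} {s : Set ℂ}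
    (hs : s.Finite) (h : ∀ t ∉ s, MvPolynomial.eval (u + t • v) f = 0) : dirDeriv f u v = 0 := by
  have h0 : lineRestriction u v f = 0 := by
    refine Polynomial.funext fun t => ?_
    rw [eval_lineRestriction, eval_eq_zero_of_line_of_finite hs h, Polynomial.eval_zero]
  rw [← derivative_lineRestriction, h0, Polynomial.derivative_zero, Polynomial.eval_zero]

end DirectionalDerivative

/-! ### Vanishing ideals of projective sets -/

section VanishingIdeal

variable {ι V : Type} [AddCommGroup V] [Module ℂ V] [Finite ι] {b : Module.Basis ι ℂ V}

theorem zariskiClosure_congr {X Y : Set (ℙ ℂ V)} (h : vanishingIdeal b X = vanishingIdeal b Y) :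
    zariskiClosure b X = zariskiClosure b Y := by
  unfold zariskiClosure
  rw [h]

theorem subset_zariskiClosure (X : Set (ℙ ℂ V)) : X ⊆ zariskiClosure b X := by
  rintro p hp f hf v hv rfl
  exact hf v hv hp

theorem mk_smul_eq {v : V} (hv : v ≠ 0) {c : ℂ} (hc : c ≠ 0) :
    Projectivization.mk ℂ (c • v) (smul_ne_zero hc hv) = Projectivization.mk ℂ v hv :=
  (Projectivization.mk_eq_mk_iff' ℂ _ _ _ _).2 ⟨c, rfl⟩

theorem isZariskiClosed_zeros (f : MvPolynomial ι ℂ) :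
    IsZariskiClosed b {p : ℙ ℂ V | ∀ (v : V) (hv : v ≠ 0), Projectivization.mk ℂ v hv = p →
      MvPolynomial.eval (b.equivFun v) f = 0} := by
  refine Set.Subset.antisymm (fun p hp => ?_) (subset_zariskiClosure _)
  exact hp f fun v hv h => h v hv rfl

/-- Irreducibility is applied to the loci where f, respectively g, vanishes at all representatives.
As f and g need not be homogeneous, their non-vanishing at one point may be witnessed by different
representatives; the line through these and the origin lets them be compared. -/
theorem vanishingIdeal_isPrime {X : Set (ℙ ℂ V)} (hX : IsIrreducibleVariety b X) :
    (vanishingIdeal b X).IsPrime := by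
  refine ⟨fun htop => ?_, fun {f g} hfg => ?_⟩
  · obtain ⟨p, hp⟩ := hX.nonempty
    have h1 : (1 : MvPolynomial ι ℂ) ∈ vanishingIdeal b X := htop ▸ Submodule.mem_top
    have := h1 p.rep p.rep_nonzero (by rwa [Projectivization.mk_rep])
    simp at this
  · refine (hX.irreducible _ _ (isZariskiClosed_zeros f) (isZariskiClosed_zeros g)
      fun p hp => ?_).imp (fun h v hv hp => h hp v hv rfl) (fun h v hv hp => h hp v hv rfl)
    by_contra hcon
    simp only [Set.mem_union, Set.mem_ofPred_eq, not_or, not_forall] at hcon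
    obtain ⟨⟨v, hv, rfl, hfv⟩, w, hw, hwv, hgw⟩ := hcon
    obtain ⟨c, rfl⟩ := (Projectivization.mk_eq_mk_iff' ℂ _ _ _ _).1 hwv
    have hline : ∀ t : ℂ, MvPolynomial.eval (0 + t • b.equivFun v) (f * g) = 0 := by
      refine eval_eq_zero_of_line_of_finite (Set.finite_singleton 0) fun t ht => ?_
      have := hfg (t • v) (smul_ne_zero ht hv) (by rwa [mk_smul_eq hv ht])
      rwa [map_smul, ← zero_add (t • _)] at this
    have := eval_eq_zero_of_line (u := 0) (v := b.equivFun v) (f := f) (g := g) (t₀ := c)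
      (fun t ht => (mul_eq_zero.1 ((map_mul _ f g).symm.trans (hline t))).resolve_right ht)
      (by rwa [zero_add, ← map_smul]) 1
    rw [zero_add, one_smul] at this
    exact hfv this

/-- The apex c = 0 of the cone is not a representative of a point; it is reached because a
polynomial vanishing on the rest of a line vanishes on all of it. -/
theorem eval_smul_eq_zero {X : Set (ℙ ℂ V)} {f : MvPolynomial ι ℂ} (hf : f ∈ vanishingIdeal b X)
    {v : V} (hv : v ≠ 0) (hX : Projectivization.mk ℂ v hv ∈ X) (c : ℂ) :
    MvPolynomial.eval (c • b.equivFun v) f = 0 := by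
  rw [← zero_add (c • _)]
  refine eval_eq_zero_of_line_of_finite (Set.finite_singleton 0) (fun t ht => ?_) c
  have := hf (t • v) (smul_ne_zero ht hv) (by rwa [mk_smul_eq hv ht])
  rwa [map_smul, ← zero_add (t • _)] at this

theorem HasDim.unique {X : Set (ℙ ℂ V)} {d e : ℕ} (hd : HasDim b X d) (he : HasDim b X e) :
    d = e := by
  have h : ((d + 1 : ℕ) : WithBot ℕ∞) = ((e + 1 : ℕ) : WithBot ℕ∞) := hd.symm.trans he
  have : d + 1 = e + 1 := by exact_mod_cast h
  omega

end VanishingIdeal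

/-! ### Coordinates of vectors and matrices -/

section Coordinates

theorem coordBasis_equivFun (N : ℕ) (v : Fin N → ℂ) : (coordBasis N).equivFun v = v := by
  ext j
  simp

theorem matBasis_equivFun {m N : ℕ} (M : Matrix (Fin m) (Fin N) ℂ) :
    (matBasis m N).equivFun M = fun p => M p.1 p.2 := by
  ext p
  have h : M = ∑ q : Fin m × Fin N, M q.1 q.2 • matBasis m N q := by
    conv_lhs => rw [Matrix.matrix_eq_sum_single M]
    rw [Fintype.sum_prod_type]
    simp [Matrix.stdBasis_eq_single, Matrix.smul_single]
  conv_lhs => rw [h]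
  simp [Finsupp.single_apply, map_sum]

end Coordinates

/-! ### The Segre product and its dimension -/

section Segre

variable {m N : ℕ} {X : Set (ℙ ℂ (Fin N → ℂ))}

theorem vecMulVec_ne_zero {y : Fin m → ℂ} {x : Fin N → ℂ} (hy : y ≠ 0) (hx : x ≠ 0) :
    Matrix.vecMulVec y x ≠ 0 := by
  intro h
  obtain ⟨a, ha⟩ := Function.ne_iff.1 hy
  obtain ⟨c, hc⟩ := Function.ne_iff.1 hx
  exact mul_ne_zero ha hc (congrFun (congrFun h a) c)

theorem segre_mk {y : Fin m → ℂ} {x : Fin N → ℂ} (hy : y ≠ 0) (hx : x ≠ 0) :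
    segre (Projectivization.mk ℂ y hy) (Projectivization.mk ℂ x hx) =
      Projectivization.mk ℂ (Matrix.vecMulVec y x) (vecMulVec_ne_zero hy hx) := by
  obtain ⟨c, hc⟩ := Projectivization.exists_smul_eq_mk_rep ℂ y hy
  obtain ⟨d, hd⟩ := Projectivization.exists_smul_eq_mk_rep ℂ x hx
  refine (Projectivization.mk_eq_mk_iff' ℂ _ _ _ _).2 ⟨(c : ℂ) * d, ?_⟩
  rw [← hc, ← hd]
  ext a j
  simp [Matrix.vecMulVec_apply, Units.smul_def]
  ring

theorem mk_vecMulVec_mem {y : Fin m → ℂ} {x : Fin N → ℂ} (hy : y ≠ 0) (hx : x ≠ 0)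
    (hX : Projectivization.mk ℂ x hx ∈ X) :
    Projectivization.mk ℂ (Matrix.vecMulVec y x) (vecMulVec_ne_zero hy hx) ∈
      segreProduct Set.univ X :=
  ⟨_, Set.mem_univ (Projectivization.mk ℂ y hy), _, hX, segre_mk hy hx⟩

theorem exists_eq_vecMulVec_of_mk_mem {M : Matrix (Fin m) (Fin N) ℂ} (hM : M ≠ 0)
    (h : Projectivization.mk ℂ M hM ∈ segreProduct Set.univ X) :
    ∃ (y : Fin m → ℂ) (x : Fin N → ℂ) (hx : x ≠ 0), y ≠ 0 ∧ Projectivization.mk ℂ x hx ∈ X ∧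
      M = Matrix.vecMulVec y x := by
  obtain ⟨q, -, p, hp, hpq⟩ := h
  obtain ⟨c, hc⟩ := (Projectivization.mk_eq_mk_iff' ℂ _ _ _ _).1 hpq.symm
  refine ⟨c • q.rep, p.rep, p.rep_nonzero, ?_, by rwa [Projectivization.mk_rep], ?_⟩
  · rintro h0
    apply hM
    rw [← hc, ← Matrix.smul_vecMulVec, h0, Matrix.zero_vecMulVec]
  · rw [Matrix.smul_vecMulVec, hc]

/-- Admitting y = 0 allows y to run through whole lines when derivatives are taken later. -/
theorem mem_vanishingIdeal_segreProduct {f : MvPolynomial (Fin (m + 1) × Fin N) ℂ} :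
    f ∈ vanishingIdeal (matBasis (m + 1) N) (segreProduct Set.univ X) ↔
      ∀ (y : Fin (m + 1) → ℂ) (x : Fin N → ℂ) (hx : x ≠ 0), Projectivization.mk ℂ x hx ∈ X →
        MvPolynomial.eval (fun p => y p.1 * x p.2) f = 0 := by
  constructor
  · intro hf y x hx hX
    have key : ∀ y : Fin (m + 1) → ℂ, y ≠ 0 → ∀ c : ℂ,
        MvPolynomial.eval (c • fun p : Fin (m + 1) × Fin N => y p.1 * x p.2) f = 0 := by
      intro y hy c
      have := eval_smul_eq_zero hf (vecMulVec_ne_zero hy hx) (mk_vecMulVec_mem hy hx hX) c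
      rwa [matBasis_equivFun] at this
    by_cases hy : y = 0
    · have := key (Pi.single 0 1) (by simp) 0
      rw [zero_smul] at this
      simpa [hy, Pi.zero_def] using this
    · simpa using key y hy 1
  · intro h M hM hMX
    obtain ⟨y, x, hx, -, hX, rfl⟩ := exists_eq_vecMulVec_of_mk_mem hM hMX
    rw [matBasis_equivFun]
    exact h y x hx hX

/-- The homogeneous coordinate ring. -/
abbrev CoordinateRing (X : Set (ℙ ℂ (Fin N → ℂ))) : Type :=
  MvPolynomial (Fin N) ℂ ⧸ vanishingIdeal (coordBasis N) X

/-- The homomorphism `M_ab ↦ y_a x_b`, in the chart `y_0 = 1` of the projective space. -/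
noncomputable def segreHom (m : ℕ) (X : Set (ℙ ℂ (Fin N → ℂ))) :
    MvPolynomial (Fin (m + 1) × Fin N) ℂ →ₐ[ℂ] MvPolynomial (Fin m) (CoordinateRing X) :=
  MvPolynomial.aeval fun p =>
    (Fin.cons 1 MvPolynomial.X : Fin (m + 1) → MvPolynomial (Fin m) (CoordinateRing X)) p.1 *
      MvPolynomial.C (Ideal.Quotient.mk _ (MvPolynomial.X p.2))

/-- The evaluation at a point of the affine cone. -/
noncomputable def evalCoordinateRing {x : Fin N → ℂ} (hx : x ≠ 0)
    (hX : Projectivization.mk ℂ x hx ∈ X) : CoordinateRing X →ₐ[ℂ] ℂ :=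
  Ideal.Quotient.liftₐ _ (MvPolynomial.aeval x) fun f hf => by
    have := hf x hx hX
    rwa [coordBasis_equivFun] at this

theorem evalCoordinateRing_mk {x : Fin N → ℂ} (hx : x ≠ 0)
    (hX : Projectivization.mk ℂ x hx ∈ X) (f : MvPolynomial (Fin N) ℂ) :
    evalCoordinateRing hx hX (Ideal.Quotient.mk _ f) = MvPolynomial.aeval x f :=
  rfl

theorem eval_segreHom {x : Fin N → ℂ} (hx : x ≠ 0) (hX : Projectivization.mk ℂ x hx ∈ X)
    (y : Fin m → ℂ) (f : MvPolynomial (Fin (m + 1) × Fin N) ℂ) :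
    MvPolynomial.eval y (MvPolynomial.map (evalCoordinateRing hx hX).toRingHom
      (segreHom m X f)) =
      MvPolynomial.eval (fun p => (Fin.cons 1 y : Fin (m + 1) → ℂ) p.1 * x p.2) f := by
  have h : (((MvPolynomial.aeval y).comp (MvPolynomial.mapAlgHom (evalCoordinateRing hx hX))).comp
      (segreHom m X) : MvPolynomial (Fin (m + 1) × Fin N) ℂ →ₐ[ℂ] ℂ) =
      MvPolynomial.aeval (fun p => (Fin.cons 1 y : Fin (m + 1) → ℂ) p.1 * x p.2) := by
    ext ⟨a, j⟩
    have hj : (evalCoordinateRing hx hX) (Ideal.Quotient.mk _ (MvPolynomial.X j)) = x j := by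
      rw [evalCoordinateRing_mk, MvPolynomial.aeval_X]
    refine Fin.cases ?_ (fun a => ?_) a <;> simp [segreHom, hj]
  exact DFunLike.congr_fun h f

/-- The ideal of X is defined by vanishing at points, so each coefficient of g is determined by its
values on the cone. -/
theorem eq_zero_of_eval_map_eq_zero {g : MvPolynomial (Fin m) (CoordinateRing X)}
    (h : ∀ (x : Fin N → ℂ) (hx : x ≠ 0) (hX : Projectivization.mk ℂ x hx ∈ X) (y : Fin m → ℂ),
      MvPolynomial.eval y (MvPolynomial.map (evalCoordinateRing hx hX).toRingHom g) = 0) :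
    g = 0 := by
  ext d
  obtain ⟨c, hc⟩ := Ideal.Quotient.mk_surjective (g.coeff d)
  rw [MvPolynomial.coeff_zero, ← hc, Ideal.Quotient.eq_zero_iff_mem]
  intro x hx hX
  have h0 : MvPolynomial.map (evalCoordinateRing hx hX).toRingHom g = 0 :=
    MvPolynomial.funext fun y => by rw [h x hx hX y, map_zero]
  have h1 := congrArg (MvPolynomial.coeff d) h0
  rw [MvPolynomial.coeff_map, ← hc, MvPolynomial.coeff_zero] at h1
  rw [coordBasis_equivFun]
  exact h1

/-- If y_0 ≠ 0, then y ⊗ x = (y / y_0) ⊗ (y_0 x) lies in the chart. The locus y_0 = 0 is reached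
along a line in which only the coordinate y_0 moves. -/
theorem segreHom_eq_zero_iff {f : MvPolynomial (Fin (m + 1) × Fin N) ℂ} :
    segreHom m X f = 0 ↔
      f ∈ vanishingIdeal (matBasis (m + 1) N) (segreProduct Set.univ X) := by
  rw [mem_vanishingIdeal_segreProduct]
  constructor
  · intro h
    have key : ∀ (y : Fin (m + 1) → ℂ) (x : Fin N → ℂ) (hx : x ≠ 0),
        Projectivization.mk ℂ x hx ∈ X → y 0 ≠ 0 →
        MvPolynomial.eval (fun p => y p.1 * x p.2) f = 0 := by
      intro y x hx hX hy
      have := eval_segreHom (smul_ne_zero hy hx) (by rwa [mk_smul_eq hx hy])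
        (fun a => y a.succ / y 0) f
      rw [h, map_zero, map_zero] at this
      rw [this]
      congr 1
      congr 1
      ext ⟨a, j⟩
      refine Fin.cases ?_ (fun a => ?_) a
      · simp
      · simp
        field_simp
    intro y x hx hX
    have := eval_eq_zero_of_line_of_finite (u := fun p : Fin (m + 1) × Fin N => y p.1 * x p.2)
      (v := fun p => (Pi.single 0 1 : Fin (m + 1) → ℂ) p.1 * x p.2) (f := f)
      (Set.finite_singleton (-y 0)) (fun t ht => ?_) 0
    · simpa using this
    · convert key (y + t • Pi.single 0 1) x hx hX ?_ using 3
      · ext p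
        simp
        ring
      · simpa [add_eq_zero_iff_eq_neg, ← eq_neg_iff_add_eq_zero, eq_neg_iff_add_eq_zero, add_comm]
          using ht
  · intro h
    refine eq_zero_of_eval_map_eq_zero fun x hx hX y => ?_
    rw [eval_segreHom, h _ x hx hX]

/-- If a finitely generated domain `A` is embedded in `C[X_1, …, X_m]` such that its image contains
generators `x_j` of `C` and the products `x_j X_a` for some `x_j ≠ 0`, then its Krull dimension is
that of `C[X_1, …, X_m]`. -/
theorem ringKrullDim_eq_add_of_injective {K A C ι : Type*} [Field K] [CommRing A] [CommRing C]
    [IsDomain C] [Algebra K A] [Algebra K C] [Algebra.FiniteType K A] [Algebra.FiniteType K C]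
    (ψ : A →ₐ[K] MvPolynomial (Fin m) C) (hψ : Function.Injective ψ) {x : ι → C}
    (hgen : Algebra.adjoin K (Set.range x) = ⊤) {j : ι} (hj : x j ≠ 0)
    (hx : ∀ j, MvPolynomial.C (x j) ∈ ψ.range)
    (hy : ∀ a, MvPolynomial.C (x j) * MvPolynomial.X a ∈ ψ.range) :
    ringKrullDim A = ringKrullDim C + m := by
  have : IsDomain A := hψ.isDomain ψ.toRingHom
  have : Algebra.FiniteType K (MvPolynomial (Fin m) C) :=
    Algebra.FiniteType.trans (S := C) inferInstance inferInstance
  have : IsNoetherianRing C := Algebra.FiniteType.isNoetherianRing K C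
  algebraize [ψ.toRingHom]
  have : IsScalarTower K A (MvPolynomial (Fin m) C) :=
    IsScalarTower.of_algebraMap_eq fun c => (ψ.commutes c).symm
  have : FaithfulSMul A (MvPolynomial (Fin m) C) :=
    (faithfulSMul_iff_algebraMap_injective _ _).2 hψ
  have hmem : ∀ g ∈ ψ.range, IsAlgebraic A g := by
    rintro _ ⟨a, rfl⟩
    exact isAlgebraic_algebraMap (R := A) (A := MvPolynomial (Fin m) C) a
  have hC : ∀ c : C, IsAlgebraic A (MvPolynomial.C c : MvPolynomial (Fin m) C) := by
    intro c
    have hc : c ∈ Algebra.adjoin K (Set.range x) := hgen ▸ Algebra.mem_top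
    refine hmem _ (?_ : c ∈ ψ.range.comap (IsScalarTower.toAlgHom K C (MvPolynomial (Fin m) C)))
    refine Algebra.adjoin_le ?_ hc
    rintro _ ⟨j, rfl⟩
    exact hx j
  have : Algebra.IsAlgebraic A (MvPolynomial (Fin m) C) := ⟨fun g => by
    induction g using MvPolynomial.induction_on with
    | C c => exact hC c
    | add p q hp hq => exact hp.add hq
    | mul_X p a hp =>
      -- The variable is algebraic because x_j and its product with x_j are, and x_j is not a zero
      -- divisor.
      exact hp.mul (IsAlgebraic.of_mul (mem_nonZeroDivisors_of_ne_zero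
        ((MvPolynomial.C_eq_zero (σ := Fin m)).not.2 hj)) (hC _) (hmem _ (hy a)))⟩
  rw [ringKrullDim_eq_of_isAlgebraic K (A := A) (B := MvPolynomial (Fin m) C),
    MvPolynomial.ringKrullDim_of_isNoetherianRing]
  simp

/-- Through `segreHom` the coordinate ring of the product embeds in a polynomial ring in m variables
over that of X, as a subring over which everything is algebraic. Its dimension is therefore (k + 1)
+ m. -/
theorem hasDim_segreProduct {k : ℕ} (hX : IsIrreducibleVariety (coordBasis N) X)
    (hk : HasDim (coordBasis N) X k) (m : ℕ) :
    HasDim (matBasis (m + 1) N) (segreProduct (Set.univ : Set (ℙ ℂ (Fin (m + 1) → ℂ))) X)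
      (k + m) := by
  have hprime := vanishingIdeal_isPrime hX
  obtain ⟨p, hp⟩ := hX.nonempty
  obtain ⟨j, hj⟩ := Function.ne_iff.1 p.rep_nonzero
  have hj0 : (Ideal.Quotient.mk _ (MvPolynomial.X j) : CoordinateRing X) ≠ 0 := by
    rw [Ne, Ideal.Quotient.eq_zero_iff_mem]
    intro h
    have := h p.rep p.rep_nonzero (by rwa [Projectivization.mk_rep])
    rw [coordBasis_equivFun, MvPolynomial.eval_X] at this
    exact hj this
  have hgen : Algebra.adjoin ℂ (Set.range fun j =>
      (Ideal.Quotient.mkₐ ℂ (vanishingIdeal (coordBasis N) X) (MvPolynomial.X j))) = ⊤ := by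
    rw [← Function.comp_def, Set.range_comp, ← AlgHom.map_adjoin, MvPolynomial.adjoin_range_X,
      Algebra.map_top, AlgHom.range_eq_top]
    exact Ideal.Quotient.mkₐ_surjective _ _
  have h := ringKrullDim_eq_add_of_injective
    (Ideal.Quotient.liftₐ (vanishingIdeal (matBasis (m + 1) N) (segreProduct Set.univ X))
      (segreHom m X) fun f hf => segreHom_eq_zero_iff.2 hf) ?_ hgen hj0
    (fun j => ⟨Ideal.Quotient.mk _ (MvPolynomial.X (0, j)), ?_⟩)
    (fun a => ⟨Ideal.Quotient.mk _ (MvPolynomial.X (a.succ, j)), ?_⟩)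
  · rw [HasDim, h, show ringKrullDim (CoordinateRing X) = ((k + 1 : ℕ) : WithBot ℕ∞) from hk]
    push_cast
    ring
  · refine (injective_iff_map_eq_zero _).2 fun a ha => ?_
    obtain ⟨f, rfl⟩ := Ideal.Quotient.mk_surjective a
    exact Ideal.Quotient.eq_zero_iff_mem.2 (segreHom_eq_zero_iff.1 ha)
  · change segreHom m X _ = _
    rw [segreHom, MvPolynomial.aeval_X, Fin.cons_zero, one_mul]
    rfl
  · change segreHom m X _ = _
    rw [segreHom, MvPolynomial.aeval_X, Fin.cons_succ, mul_comm]
    rfl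

end Segre

/-! ### Embedded tangent spaces and smooth points -/

section TangentSpace

variable {ι V : Type} [AddCommGroup V] [Module ℂ V] [Fintype ι] {b : Module.Basis ι ℂ V}
  {X : Set (ℙ ℂ V)}

/-- The ideal is stable under the substitution of cX for X, and the chain rule turns this
substitution into a factor c. This makes the tangent space independent of the representative. -/
theorem dirDeriv_smul_left_eq_zero {u : V} {w : ι → ℂ}
    (h : ∀ f ∈ vanishingIdeal b X, dirDeriv f (b.equivFun u) w = 0) {c : ℂ} (hc : c ≠ 0) :
    ∀ f ∈ vanishingIdeal b X, dirDeriv f (b.equivFun (c • u)) w = 0 := by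
  intro f hf
  have heval : ∀ v : ι → ℂ, (fun j => MvPolynomial.eval v
      (MvPolynomial.C c * MvPolynomial.X j : MvPolynomial ι ℂ)) = c • v := by
    intro v
    ext j
    simp
  have hg : MvPolynomial.bind₁ (fun j => MvPolynomial.C c * MvPolynomial.X j) f ∈
      vanishingIdeal b X := by
    intro v hv hX
    refine (MvPolynomial.eval₂Hom_bind₁ _ _ _ _).trans ?_
    have := eval_smul_eq_zero hf hv hX c
    rwa [← heval] at this
  have := h _ hg
  rw [dirDeriv_bind₁, heval] at this
  have hw : (fun j => dirDeriv (MvPolynomial.C c * MvPolynomial.X j : MvPolynomial ι ℂ)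
      (b.equivFun u) w) = c • w := by
    ext j
    simp
  rw [hw, dirDeriv_smul_right, ← map_smul] at this
  exact (mul_eq_zero.1 this).resolve_left hc

theorem mem_tangentSpace_mk {v : V} (hv : v ≠ 0) {y : V} :
    y ∈ tangentSpace b X (Projectivization.mk ℂ v hv) ↔
      ∀ f ∈ vanishingIdeal b X, dirDeriv f (b.equivFun v) (b.equivFun y) = 0 := by
  obtain ⟨c, hc⟩ := Projectivization.exists_smul_eq_mk_rep ℂ v hv
  have hc' : (Projectivization.mk ℂ v hv).rep = (c : ℂ) • v := hc.symm
  change (∀ f ∈ vanishingIdeal b X, dirDeriv f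
    (b.equivFun (Projectivization.mk ℂ v hv).rep) (b.equivFun y) = 0) ↔ _
  rw [hc']
  refine ⟨fun h f hf => ?_, fun h => dirDeriv_smul_left_eq_zero h c.ne_zero⟩
  have := dirDeriv_smul_left_eq_zero h (inv_ne_zero c.ne_zero) f hf
  rwa [inv_smul_smul₀ c.ne_zero] at this

theorem self_mem_tangentSpace {v : V} (hv : v ≠ 0) (hX : Projectivization.mk ℂ v hv ∈ X) :
    v ∈ tangentSpace b X (Projectivization.mk ℂ v hv) := by
  rw [mem_tangentSpace_mk]
  intro f hf
  refine dirDeriv_eq_zero_of_line Set.finite_empty fun t _ => ?_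
  have := eval_smul_eq_zero hf hv hX (1 + t)
  rwa [add_smul, one_smul] at this

theorem mem_Reg_iff {k : ℕ} (hk : HasDim b X k) {x : ℙ ℂ V} :
    x ∈ Reg b X ↔ x ∈ X ∧ Module.finrank ℂ (tangentSpace b X x) = k + 1 := by
  refine and_congr_right fun _ => ⟨?_, fun h => ⟨k, hk, h⟩⟩
  rintro ⟨d, hd, h⟩
  rwa [hk.unique hd]

end TangentSpace

/-! ### Tangent spaces of the Segre product -/

section SegreTangentSpace

variable {m N : ℕ} {X : Set (ℙ ℂ (Fin N → ℂ))}

theorem vecMulVec_mem_tangentSpace_left {y : Fin (m + 1) → ℂ} {x : Fin N → ℂ} (hy : y ≠ 0)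
    (hx : x ≠ 0) (hX : Projectivization.mk ℂ x hx ∈ X) (z : Fin (m + 1) → ℂ) :
    Matrix.vecMulVec z x ∈ tangentSpace (matBasis (m + 1) N) (segreProduct Set.univ X)
      (Projectivization.mk ℂ (Matrix.vecMulVec y x) (vecMulVec_ne_zero hy hx)) := by
  rw [mem_tangentSpace_mk]
  intro f hf
  refine dirDeriv_eq_zero_of_line Set.finite_empty fun t _ => ?_
  rw [mem_vanishingIdeal_segreProduct] at hf
  rw [← hf (y + t • z) x hx hX, matBasis_equivFun, matBasis_equivFun]
  congr 2
  ext p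
  simp [Matrix.vecMulVec_apply]
  ring

/-- The linear map w ↦ y ⊗ w carries the cone over X into the cone over the product, so equations
pull back and tangent vectors push forward. -/
theorem vecMulVec_mem_tangentSpace_right {y : Fin (m + 1) → ℂ} {x : Fin N → ℂ} (hy : y ≠ 0)
    (hx : x ≠ 0) {v : Fin N → ℂ}
    (hv : v ∈ tangentSpace (coordBasis N) X (Projectivization.mk ℂ x hx)) :
    Matrix.vecMulVec y v ∈ tangentSpace (matBasis (m + 1) N) (segreProduct Set.univ X)
      (Projectivization.mk ℂ (Matrix.vecMulVec y x) (vecMulVec_ne_zero hy hx)) := by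
  rw [mem_tangentSpace_mk] at hv ⊢
  intro f hf
  rw [mem_vanishingIdeal_segreProduct] at hf
  have hg : MvPolynomial.bind₁ (fun p : Fin (m + 1) × Fin N =>
      MvPolynomial.C (y p.1) * MvPolynomial.X p.2) f ∈ vanishingIdeal (coordBasis N) X := by
    intro w hw hX
    rw [coordBasis_equivFun]
    refine (MvPolynomial.eval₂Hom_bind₁ _ _ _ _).trans ?_
    rw [← hf y w hw hX]
    refine congrArg (fun u => MvPolynomial.eval u f) ?_
    ext p
    simp
  have := hv _ hg
  rw [dirDeriv_bind₁, coordBasis_equivFun, coordBasis_equivFun] at this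
  rw [matBasis_equivFun, matBasis_equivFun, ← this]
  congr 1
  · ext p
    simp [Matrix.vecMulVec_apply]
  · ext p
    simp [Matrix.vecMulVec_apply]

/-- The rows of a tangent vector of `ℙ^m × X` at a point `(y, x)` that belong to non-zero
coordinates of `y` are tangent vectors of `X` at `x`. -/
theorem row_mem_tangentSpace {y : Fin (m + 1) → ℂ} {x : Fin N → ℂ} (hy : y ≠ 0) (hx : x ≠ 0)
    {M : Matrix (Fin (m + 1)) (Fin N) ℂ}
    (hM : M ∈ tangentSpace (matBasis (m + 1) N) (segreProduct Set.univ X)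
      (Projectivization.mk ℂ (Matrix.vecMulVec y x) (vecMulVec_ne_zero hy hx)))
    {a : Fin (m + 1)} (ha : y a ≠ 0) :
    M a ∈ tangentSpace (coordBasis N) X (Projectivization.mk ℂ x hx) := by
  rw [mem_tangentSpace_mk] at hM
  -- Row a of y ⊗ x is y_a x, so this representative is the image of the base point under the
  -- projection to row a, along which g is pulled back.
  rw [← mk_smul_eq hx ha, mem_tangentSpace_mk]
  intro g hg
  have hf : MvPolynomial.bind₁ (fun j => MvPolynomial.X (a, j)) g ∈
      vanishingIdeal (matBasis (m + 1) N) (segreProduct Set.univ X) := by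
    rw [mem_vanishingIdeal_segreProduct]
    intro z w hw hX
    refine (MvPolynomial.eval₂Hom_bind₁ _ _ _ _).trans ?_
    have := eval_smul_eq_zero hg hw hX (z a)
    rw [coordBasis_equivFun] at this
    rw [← this]
    refine congrArg (fun u => MvPolynomial.eval u g) ?_
    ext j
    simp
  have := hM _ hf
  rw [dirDeriv_bind₁, matBasis_equivFun, matBasis_equivFun] at this
  rw [coordBasis_equivFun, coordBasis_equivFun, ← this]
  congr 1
  · ext p
    simp [Matrix.vecMulVec_apply]
  · ext p
    simp

/-- The linearized equations of the Segre variety. -/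
theorem minor_of_mem_tangentSpace {y : Fin (m + 1) → ℂ} {x : Fin N → ℂ} (hy : y ≠ 0) (hx : x ≠ 0)
    {M : Matrix (Fin (m + 1)) (Fin N) ℂ}
    (hM : M ∈ tangentSpace (matBasis (m + 1) N) (segreProduct Set.univ X)
      (Projectivization.mk ℂ (Matrix.vecMulVec y x) (vecMulVec_ne_zero hy hx)))
    (a c : Fin (m + 1)) (j l : Fin N) :
    y a * x j * M c l + M a j * (y c * x l) = y a * x l * M c j + M a l * (y c * x j) := by
  rw [mem_tangentSpace_mk] at hM
  have hf : (MvPolynomial.X (a, j) * MvPolynomial.X (c, l) -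
      MvPolynomial.X (a, l) * MvPolynomial.X (c, j) : MvPolynomial (Fin (m + 1) × Fin N) ℂ) ∈
      vanishingIdeal (matBasis (m + 1) N) (segreProduct Set.univ X) := by
    rw [mem_vanishingIdeal_segreProduct]
    intro z w hw hX
    simp
    ring
  have := hM _ hf
  rw [matBasis_equivFun, matBasis_equivFun] at this
  simp [Matrix.vecMulVec_apply] at this
  linear_combination this

/-- The embedded tangent space of `ℙ^m × X` at `(y, x)` is `ℂ^(m+1) ⊗ x + y ⊗ T_x X`. -/
theorem mem_tangentSpace_segreProduct {y : Fin (m + 1) → ℂ} {x : Fin N → ℂ} (hy : y ≠ 0)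
    (hx : x ≠ 0) (hX : Projectivization.mk ℂ x hx ∈ X) {M : Matrix (Fin (m + 1)) (Fin N) ℂ} :
    M ∈ tangentSpace (matBasis (m + 1) N) (segreProduct Set.univ X)
      (Projectivization.mk ℂ (Matrix.vecMulVec y x) (vecMulVec_ne_zero hy hx)) ↔
    ∃ z, ∃ v ∈ tangentSpace (coordBasis N) X (Projectivization.mk ℂ x hx),
      Matrix.vecMulVec z x + Matrix.vecMulVec y v = M := by
  constructor
  · intro hM
    obtain ⟨a, ha⟩ := Function.ne_iff.1 hy
    obtain ⟨j, hj⟩ := Function.ne_iff.1 hx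
    rw [Pi.zero_apply] at ha hj
    -- Choose v so that y ⊗ v accounts for all of row a; column j then forces z. The minors through
    -- (a, j) give the remaining entries.
    refine ⟨fun c => M c j / x j - M a j * y c / (y a * x j), (y a)⁻¹ • M a,
      Submodule.smul_mem _ _ (row_mem_tangentSpace hy hx hM ha), ?_⟩
    ext c l
    have := minor_of_mem_tangentSpace hy hx hM a c j l
    simp only [Matrix.add_apply, Matrix.vecMulVec_apply, Pi.smul_apply, smul_eq_mul]
    field_simp
    linear_combination -this
  · rintro ⟨z, v, hv, rfl⟩
    exact add_mem (vecMulVec_mem_tangentSpace_left hy hx hX z)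
      (vecMulVec_mem_tangentSpace_right hy hx hv)

/-- The map `(z, v) ↦ z ⊗ x + y ⊗ v`. -/
def tensorMap (y : Fin m → ℂ) (x : Fin N → ℂ) (T : Submodule ℂ (Fin N → ℂ)) :
    (Fin m → ℂ) × T →ₗ[ℂ] Matrix (Fin m) (Fin N) ℂ where
  toFun p := Matrix.vecMulVec p.1 x + Matrix.vecMulVec y p.2
  map_add' p q := by
    ext a j
    simp [Matrix.vecMulVec_apply]
    ring
  map_smul' c p := by
    ext a j
    simp [Matrix.vecMulVec_apply]
    ring

/-- The two summands overlap only in the multiples of y ⊗ x, so the kernel is the line spanned by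
(y, -x). -/
theorem finrank_range_tensorMap {y : Fin m → ℂ} {x : Fin N → ℂ} (hy : y ≠ 0) (hx : x ≠ 0)
    {T : Submodule ℂ (Fin N → ℂ)} (hxT : x ∈ T) :
    Module.finrank ℂ (LinearMap.range (tensorMap y x T)) + 1 = m + Module.finrank ℂ T := by
  have hker : LinearMap.ker (tensorMap y x T) = ℂ ∙ (y, (-⟨x, hxT⟩ : T)) := by
    apply le_antisymm
    · rintro ⟨z, v⟩ h
      obtain ⟨a, ha⟩ := Function.ne_iff.1 hy
      obtain ⟨j, hj⟩ := Function.ne_iff.1 hx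
      rw [Pi.zero_apply] at ha hj
      have hzv : Matrix.vecMulVec z x + Matrix.vecMulVec y (v : Fin N → ℂ) = 0 :=
        LinearMap.mem_ker.1 h
      have key : ∀ c l, z c * x l + y c * (v : Fin N → ℂ) l = 0 := fun c l =>
        congrFun (congrFun hzv c) l
      have hv : ∀ l, (v : Fin N → ℂ) l = -(z a / y a) * x l := fun l => by
        have := key a l
        field_simp
        linear_combination this
      refine Submodule.mem_span_singleton.2 ⟨z a / y a, Prod.ext ?_ (Subtype.ext ?_)⟩
      · ext c
        have := key c j
        rw [hv] at this
        have h2 : (z c - z a / y a * y c) * x j = 0 := by linear_combination this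
        have h3 := (mul_eq_zero.1 h2).resolve_right hj
        simp only [Prod.smul_mk, Pi.smul_apply, smul_eq_mul]
        linear_combination -h3
      · ext l
        simp [hv]
    · rw [Submodule.span_singleton_le_iff_mem, LinearMap.mem_ker]
      ext a j
      simp [tensorMap, Matrix.vecMulVec_apply]
  have h := LinearMap.finrank_range_add_finrank_ker (tensorMap y x T)
  rw [hker, finrank_span_singleton (fun h0 => hy (congrArg Prod.fst h0)), Module.finrank_prod,
    Module.finrank_fin_fun] at h
  exact h

theorem finrank_tangentSpace_segreProduct {y : Fin (m + 1) → ℂ} {x : Fin N → ℂ} (hy : y ≠ 0)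
    (hx : x ≠ 0) (hX : Projectivization.mk ℂ x hx ∈ X) :
    Module.finrank ℂ (tangentSpace (matBasis (m + 1) N) (segreProduct Set.univ X)
      (Projectivization.mk ℂ (Matrix.vecMulVec y x) (vecMulVec_ne_zero hy hx))) =
    m + Module.finrank ℂ (tangentSpace (coordBasis N) X (Projectivization.mk ℂ x hx)) := by
  have hT : tangentSpace (matBasis (m + 1) N) (segreProduct Set.univ X)
      (Projectivization.mk ℂ (Matrix.vecMulVec y x) (vecMulVec_ne_zero hy hx)) =
      LinearMap.range (tensorMap y x
        (tangentSpace (coordBasis N) X (Projectivization.mk ℂ x hx))) := by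
    ext M
    rw [mem_tangentSpace_segreProduct hy hx hX]
    constructor
    · rintro ⟨z, v, hv, rfl⟩
      exact ⟨(z, ⟨v, hv⟩), rfl⟩
    · rintro ⟨⟨z, v⟩, rfl⟩
      exact ⟨z, v, v.2, rfl⟩
  have := finrank_range_tensorMap hy hx (self_mem_tangentSpace (b := coordBasis N) hx hX)
  rw [hT]
  omega

/-- The smooth points of `ℙ^m × X` are the pairs `(y, x)` with `x` a smooth point of `X`. -/
theorem mem_Reg_segreProduct_iff {k : ℕ} (hX : IsIrreducibleVariety (coordBasis N) X)
    (hk : HasDim (coordBasis N) X k) {P : ℙ ℂ (Matrix (Fin (m + 1)) (Fin N) ℂ)} :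
    P ∈ Reg (matBasis (m + 1) N) (segreProduct Set.univ X) ↔
      ∃ (y : Fin (m + 1) → ℂ) (x : Fin N → ℂ) (hy : y ≠ 0) (hx : x ≠ 0),
        Projectivization.mk ℂ x hx ∈ Reg (coordBasis N) X ∧
        Projectivization.mk ℂ (Matrix.vecMulVec y x) (vecMulVec_ne_zero hy hx) = P := by
  simp only [mem_Reg_iff (hasDim_segreProduct hX hk m), mem_Reg_iff hk]
  constructor
  · induction P using Projectivization.ind with
    | h M hM =>
      rintro ⟨hmem, hrank⟩
      obtain ⟨y, x, hx, hy, hxX, rfl⟩ := exists_eq_vecMulVec_of_mk_mem hM hmem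
      rw [finrank_tangentSpace_segreProduct hy hx hxX] at hrank
      exact ⟨y, x, hy, hx, ⟨hxX, by omega⟩, rfl⟩
  · rintro ⟨y, x, hy, hx, ⟨hxX, hrank⟩, rfl⟩
    refine ⟨mk_vecMulVec_mem hy hx hxX, ?_⟩
    rw [finrank_tangentSpace_segreProduct hy hx hxX]
    omega

end SegreTangentSpace

/-! ### Plücker coordinates and closures in the Grassmannian -/

section Plucker

variable {m N : ℕ}

/-- A matrix of full rank has a maximal minor, possibly with permuted columns, that is not zero. -/
theorem exists_injective_det_submatrix_ne_zero {A : Matrix (Fin m) (Fin N) ℂ} (hA : A.rank = m) :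
    ∃ u : Fin m → Fin N, (A.submatrix id u).det ≠ 0 := by
  obtain ⟨f, hf, -, hli⟩ := Submodule.exists_fun_fin_finrank_span_eq ℂ (Set.range A.col)
  have hr : m = Module.finrank ℂ (Submodule.span ℂ (Set.range A.col)) := by
    rw [← Matrix.rank_eq_finrank_span_cols, hA]
  choose e he using hf
  refine ⟨fun a => e (Fin.cast hr a), ?_⟩
  have hcol : (A.submatrix id fun a => e (Fin.cast hr a)).col = f ∘ Fin.cast hr := by
    ext1 a
    exact he (Fin.cast hr a)
  have hli' := hli.comp (Fin.cast hr) (Fin.cast_injective hr)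
  rw [← hcol, Matrix.linearIndependent_cols_iff_isUnit, Matrix.isUnit_iff_isUnit_det] at hli'
  exact hli'.ne_zero

theorem exists_orderEmbedding_comp_eq {u : Fin m → Fin N} (hu : Function.Injective u) :
    ∃ (s : Fin m ↪o Fin N) (σ : Equiv.Perm (Fin m)), s ∘ σ = u := by
  have hmono : StrictMono (u ∘ Tuple.sort u) :=
    (Tuple.monotone_sort u).strictMono_of_injective (hu.comp (Tuple.sort u).injective)
  refine ⟨OrderEmbedding.ofStrictMono _ hmono, (Tuple.sort u).symm, ?_⟩
  ext a
  simp

theorem det_submatrix_comp (A : Matrix (Fin m) (Fin N) ℂ) (s : Fin m → Fin N)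
    (σ : Equiv.Perm (Fin m)) :
    (A.submatrix id (s ∘ σ)).det = Equiv.Perm.sign σ * (A.submatrix id s).det :=
  Matrix.det_permute' σ (A.submatrix id s)

theorem injective_of_det_submatrix_ne_zero {A : Matrix (Fin m) (Fin N) ℂ} {u : Fin m → Fin N}
    (h : (A.submatrix id u).det ≠ 0) : Function.Injective u := by
  intro a c hac
  by_contra hne
  exact h (Matrix.det_zero_of_column_eq hne fun r => by simp [hac])

theorem exists_minor_ne_zero {A : Matrix (Fin m) (Fin N) ℂ} (hA : A.rank = m) :
    ∃ s : Fin m ↪o Fin N, (A.submatrix id s).det ≠ 0 := by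
  obtain ⟨u, hu⟩ := exists_injective_det_submatrix_ne_zero hA
  obtain ⟨s, σ, rfl⟩ := exists_orderEmbedding_comp_eq (injective_of_det_submatrix_ne_zero hu)
  rw [det_submatrix_comp] at hu
  exact ⟨s, right_ne_zero_of_mul hu⟩

theorem rank_eq_of_det_submatrix_ne_zero {A : Matrix (Fin m) (Fin N) ℂ} {u : Fin m → Fin N}
    (h : (A.submatrix id u).det ≠ 0) : A.rank = m := by
  refine le_antisymm A.rank_le_height ?_
  have := A.rank_submatrix_le id u
  rwa [Matrix.rank_of_isUnit _ ((Matrix.isUnit_iff_isUnit_det _).2 h.isUnit),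
    Fintype.card_fin] at this

/-- The minors with arbitrary columns are polynomials in the Plücker coordinates. -/
theorem exists_eval_plucker_eq_det (u : Fin m → Fin N) :
    ∃ P : MvPolynomial (Fin m ↪o Fin N) ℂ, ∀ A : Stiefel m N,
      MvPolynomial.eval (plucker A) P = (A.1.submatrix id u).det := by
  by_cases hu : Function.Injective u
  · obtain ⟨s, σ, rfl⟩ := exists_orderEmbedding_comp_eq hu
    refine ⟨MvPolynomial.C ((Equiv.Perm.sign σ : ℤ) : ℂ) * MvPolynomial.X s, fun A => ?_⟩
    rw [det_submatrix_comp, map_mul, MvPolynomial.eval_C, MvPolynomial.eval_X]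
    rfl
  · refine ⟨0, fun A => ?_⟩
    rw [map_zero]
    by_contra h
    exact hu (injective_of_det_submatrix_ne_zero (Ne.symm h))

/-- The entries of `adj(A_s) A` are the minors of `A` with one column of `A_s` replaced. -/
theorem adjugate_submatrix_mul_apply (A : Matrix (Fin m) (Fin N) ℂ) (s : Fin m → Fin N)
    (a : Fin m) (j : Fin N) :
    ((A.submatrix id s).adjugate * A) a j = (A.submatrix id (Function.update s a j)).det := by
  have h : ((A.submatrix id s).adjugate * A) a j =
      ((A.submatrix id s).adjugate.mulVec fun c => A c j) a := rfl
  rw [h, ← Matrix.cramer_eq_adjugate_mulVec, Matrix.cramer_apply]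
  congr 1
  ext c d
  by_cases hd : d = a
  · subst hd
    simp
  · simp [Matrix.updateCol_ne hd, Function.update_of_ne hd]

theorem ker_mulVecLin_mul {A : Matrix (Fin m) (Fin N) ℂ} {g : Matrix (Fin m) (Fin m) ℂ}
    (hg : g.det ≠ 0) : LinearMap.ker (g * A).mulVecLin = LinearMap.ker A.mulVecLin := by
  ext v
  simp only [LinearMap.mem_ker, Matrix.mulVecLin_apply, ← Matrix.mulVec_mulVec]
  refine ⟨fun h => ?_, fun h => by rw [h, Matrix.mulVec_zero]⟩
  by_contra hne
  exact hg (Matrix.exists_mulVec_eq_zero_iff.1 ⟨_, hne, h⟩)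

/-- The action of an invertible matrix on the Stiefel variety. -/
def Stiefel.mul (g : Matrix (Fin m) (Fin m) ℂ) (hg : g.det ≠ 0) (A : Stiefel m N) : Stiefel m N :=
  ⟨g * A.1, (Matrix.rank_mul_eq_right_of_isUnit_det _ _ hg.isUnit).trans A.2⟩

theorem stiefelKer_mul (g : Matrix (Fin m) (Fin m) ℂ) (hg : g.det ≠ 0) (A : Stiefel m N) :
    stiefelKer (A.mul g hg) = stiefelKer A :=
  Subtype.ext (ker_mulVecLin_mul hg)

/-- A polynomial in the entries of a matrix that vanishes on the preimage of a set `S` of the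
Grassmannian vanishes on the preimage of the Zariski closure of `S`. -/
theorem eval_eq_zero_of_mem_grClosure {S : Set (Gr m N)} {f : MvPolynomial (Fin m × Fin N) ℂ}
    (hf : ∀ A : Stiefel m N, stiefelKer A ∈ S →
      MvPolynomial.eval (fun p => A.1 p.1 p.2) f = 0)
    {A : Stiefel m N} (hA : stiefelKer A ∈ grClosure S) :
    MvPolynomial.eval (fun p => A.1 p.1 p.2) f = 0 := by
  obtain ⟨s, hs⟩ := exists_minor_ne_zero A.2
  have hadj : (A.1.submatrix id s).adjugate.det ≠ 0 := by
    rw [Matrix.det_adjugate]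
    exact pow_ne_zero _ hs
  set g := (A.1.submatrix id s).adjugate with hgdef
  have hginv : g⁻¹.det ≠ 0 := (g.isUnit_nonsing_inv_det hadj.isUnit).ne_zero
  choose Q hQ using fun u : Fin m → Fin N => exists_eval_plucker_eq_det u
  -- The matrix g⁻¹ adj(B_s) B has entries that are polynomials in the Plücker coordinates of B, has
  -- the same kernel as B if B_s is invertible, and equals A for B = A. The factor `X s` disposes of
  -- the B with singular B_s.
  let P : MvPolynomial (Fin m ↪o Fin N) ℂ := MvPolynomial.X s * MvPolynomial.bind₁
    (fun p : Fin m × Fin N => ∑ c, MvPolynomial.C (g⁻¹ p.1 c) * Q (Function.update s c p.2)) f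
  have hP : ∀ B : Stiefel m N, MvPolynomial.eval (plucker B) P = (B.1.submatrix id s).det *
      MvPolynomial.eval
        (fun p => (g⁻¹ * ((B.1.submatrix id s).adjugate * B.1)) p.1 p.2) f := by
    intro B
    rw [map_mul, MvPolynomial.eval_X]
    refine congrArg₂ _ rfl ((MvPolynomial.eval₂Hom_bind₁ _ _ _ _).trans ?_)
    refine congrArg (fun u => MvPolynomial.eval u f) ?_
    ext p
    rw [Matrix.mul_apply]
    change MvPolynomial.eval (plucker B) _ = _
    rw [map_sum]
    refine Finset.sum_congr rfl fun c _ => ?_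
    rw [map_mul, MvPolynomial.eval_C, hQ, adjugate_submatrix_mul_apply]
  have hzero := hA P (fun B hB => ?_) A rfl
  · rw [hP, ← hgdef, Matrix.nonsing_inv_mul_cancel_left (A := g) A.1 hadj.isUnit] at hzero
    exact (mul_eq_zero.1 hzero).resolve_left hs
  · rw [hP]
    by_cases hBs : (B.1.submatrix id s).det = 0
    · rw [hBs, zero_mul]
    · have hBadj : (B.1.submatrix id s).adjugate.det ≠ 0 := by
        rw [Matrix.det_adjugate]
        exact pow_ne_zero _ hBs
      have := hf ((B.mul _ hBadj).mul _ hginv) (by rwa [stiefelKer_mul, stiefelKer_mul])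
      exact mul_eq_zero_of_right _ this

theorem subset_grClosure (S : Set (Gr m N)) : S ⊆ grClosure S := by
  rintro _ hL P hP A rfl
  exact hP A hL

theorem Stiefel.ne_zero (A : Stiefel (m + 1) N) : A.1 ≠ 0 := by
  intro h
  have := A.2
  rw [h, Matrix.rank_zero] at this
  omega

/-- Non-zero multiples of a matrix have the same kernel, so the preimage of S already contains all
representatives of its points. -/
theorem mem_vanishingIdeal_matrixPoints {S : Set (Gr (m + 1) N)}
    {f : MvPolynomial (Fin (m + 1) × Fin N) ℂ} :
    f ∈ vanishingIdeal (matBasis (m + 1) N) (matrixPoints (stiefelKer ⁻¹' S)) ↔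
      ∀ A : Stiefel (m + 1) N, stiefelKer A ∈ S →
        MvPolynomial.eval (fun p => A.1 p.1 p.2) f = 0 := by
  constructor
  · intro hf A hA
    have := hf A.1 A.ne_zero ⟨A, hA, A.ne_zero, rfl⟩
    rwa [matBasis_equivFun] at this
  · rintro h M hM ⟨A, hA, hA0, hMA⟩
    obtain ⟨c, rfl⟩ := (Projectivization.mk_eq_mk_iff' ℂ _ _ _ _).1 hMA
    have hc : c ≠ 0 := by
      rintro rfl
      simp at hM
    have hg : (c • (1 : Matrix (Fin (m + 1)) (Fin (m + 1)) ℂ)).det ≠ 0 := by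
      simp [hc]
    have := h (A.mul _ hg) (by rwa [stiefelKer_mul])
    rw [matBasis_equivFun]
    simpa [Stiefel.mul] using this

theorem vanishingIdeal_matrixPoints_grClosure (S : Set (Gr (m + 1) N)) :
    vanishingIdeal (matBasis (m + 1) N) (matrixPoints (stiefelKer ⁻¹' grClosure S)) =
      vanishingIdeal (matBasis (m + 1) N) (matrixPoints (stiefelKer ⁻¹' S)) := by
  ext f
  rw [mem_vanishingIdeal_matrixPoints, mem_vanishingIdeal_matrixPoints]
  exact ⟨fun h A hA => h A (subset_grClosure S hA),
    fun h A hA => eval_eq_zero_of_mem_grClosure h hA⟩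

end Plucker

/-! ### Duality in coordinates -/

section DualVariety

variable {ι V : Type} [AddCommGroup V] [Module ℂ V] [Fintype ι] [DecidableEq ι]
  {b : Module.Basis ι ℂ V}

/-- `b.toDual` is a bijection that identifies coordinates in `b` with those in `b.dualBasis`, so the
same polynomials cut out both closures. -/
theorem dualStar_zariskiClosure (S : Set (ℙ ℂ (Module.Dual ℂ V))) :
    dualStar b (zariskiClosure b.dualBasis S) = zariskiClosure b (dualStar b S) := by
  have hcoord : ∀ v, b.dualBasis.equivFun (b.toDual v) = b.equivFun v := by
    intro v
    ext j
    rw [Module.Basis.dualBasis_equivFun, Module.Basis.toDual_eq_equivFun]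
  have hsurj : ∀ φ : Module.Dual ℂ V, ∃ v, b.toDual v = φ := fun φ =>
    ⟨b.toDualEquiv.symm φ, b.toDualEquiv.apply_symm_apply φ⟩
  have hne : ∀ {v}, v ≠ 0 → b.toDual v ≠ 0 := fun hv =>
    (map_ne_zero_iff _ b.toDual_injective).2 hv
  have hideal : vanishingIdeal b.dualBasis S = vanishingIdeal b (dualStar b S) := by
    ext f
    constructor
    · intro hf v hv hS
      rw [← hcoord]
      exact hf _ (hne hv) hS
    · intro hf φ hφ hS
      obtain ⟨v, rfl⟩ := hsurj φ
      rw [hcoord]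
      exact hf v (fun h => hφ (by rw [h, map_zero])) hS
  ext P
  induction P using Projectivization.ind with
  | h w hw =>
    constructor
    · rintro h f hf v hv hvw
      rw [← hcoord]
      exact h f (hideal ▸ hf) _ (hne hv) (congrArg (hyperplaneOfPoint b) hvw)
    · rintro h f hf φ hφ hφw
      obtain ⟨v, rfl⟩ := hsurj φ
      have hv : v ≠ 0 := fun h => hφ (by rw [h, map_zero])
      rw [hcoord]
      refine h f (hideal ▸ hf) v hv ?_
      exact Projectivization.map_injective b.toDual b.toDual_injective hφw

theorem toDual_apply_eq_sum (v w : V) :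
    b.toDual v w = ∑ j, b.equivFun v j * b.equivFun w j := by
  conv_lhs => rw [← b.sum_equivFun w]
  simp only [map_sum, map_smul, Module.Basis.toDual_eq_equivFun, smul_eq_mul]
  exact Finset.sum_congr rfl fun j _ => mul_comm _ _

theorem mk_mem_dualStar_iff {Z : Set (ℙ ℂ V)} {v : V} (hv : v ≠ 0) :
    Projectivization.mk ℂ v hv ∈ dualStar b
      {H | ∃ x ∈ Reg b Z, tangentSpace b Z x ≤ LinearMap.ker H.rep} ↔
      ∃ x ∈ Reg b Z, ∀ w ∈ tangentSpace b Z x, ∑ j, b.equivFun v j * b.equivFun w j = 0 := by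
  have hne : b.toDual v ≠ 0 := (map_ne_zero_iff _ b.toDual_injective).2 hv
  obtain ⟨c, hc⟩ := Projectivization.exists_smul_eq_mk_rep ℂ (b.toDual v) hne
  have hH : (hyperplaneOfPoint b (Projectivization.mk ℂ v hv)).rep = (c : ℂ) • b.toDual v :=
    hc.symm
  change (∃ x ∈ Reg b Z, tangentSpace b Z x ≤
    LinearMap.ker (hyperplaneOfPoint b (Projectivization.mk ℂ v hv)).rep) ↔ _
  rw [hH, LinearMap.ker_smul _ _ c.ne_zero]
  simp only [← toDual_apply_eq_sum]
  rfl

end DualVariety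

/-! ### Matrices with prescribed tangency -/

section LinearAlgebra

theorem exists_linearEquiv_apply_eq {K V : Type*} [Field K] [AddCommGroup V] [Module K V]
    {v w : V} (hv : v ≠ 0) (hw : w ≠ 0) : ∃ g : V ≃ₗ[K] V, g v = w := by
  obtain ⟨g, hg⟩ := Submodule.exists_linearEquiv_restrict_eq
    ((LinearEquiv.toSpanNonzeroSingleton K V v hv).symm ≪≫ₗ
      LinearEquiv.toSpanNonzeroSingleton K V w hw)
  refine ⟨g, ?_⟩
  have h := hg (LinearEquiv.toSpanNonzeroSingleton K V v hv 1)
  rw [LinearEquiv.trans_apply, LinearEquiv.symm_apply_apply] at h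
  simpa using h.symm

/-- There is an injective linear map with a prescribed value at a non-zero vector, if the dimensions
allow it. -/
theorem exists_injective_linearMap_apply_eq {K V W : Type*} [Field K] [AddCommGroup V] [Module K V]
    [AddCommGroup W] [Module K W] [FiniteDimensional K V] [FiniteDimensional K W]
    (h : Module.finrank K V ≤ Module.finrank K W) {v : V} {w : W} (hv : v ≠ 0) (hw : w ≠ 0) :
    ∃ f : V →ₗ[K] W, Function.Injective f ∧ f v = w := by
  obtain ⟨f, hf⟩ := finrank_le_iff_exists_linearMap.1 h
  obtain ⟨g, hg⟩ := exists_linearEquiv_apply_eq (K := K) ((map_ne_zero_iff f hf).2 hv) hw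
  exact ⟨g.toLinearMap ∘ₗ f, g.injective.comp hf, hg⟩

theorem linearMap_apply_eq_sum {ι W : Type*} [Fintype ι] [DecidableEq ι] [AddCommGroup W]
    [Module ℂ W] (φ : (ι → ℂ) →ₗ[ℂ] W) (v : ι → ℂ) :
    φ v = ∑ j, v j • φ (Pi.single j 1) := by
  rw [LinearMap.pi_apply_eq_sum_univ φ v]
  refine Finset.sum_congr rfl fun j _ => ?_
  congr 2
  ext l
  simp [Pi.single_apply, eq_comm]

variable {m N : ℕ}

/-- For a proper subspace `T`, a vector `x` in it and a non-zero vector `y`, there is a matrix of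
full rank that maps `x` to zero and `T` to the orthogonal complement of `y`. -/
theorem exists_rank_eq_of_ne_top (hmN : m + 1 ≤ N) {T : Submodule ℂ (Fin N → ℂ)} (hT : T ≠ ⊤)
    {x : Fin N → ℂ} (hx : x ≠ 0) (hxT : x ∈ T) {y : Fin m → ℂ} (hy : y ≠ 0) :
    ∃ B : Matrix (Fin m) (Fin N) ℂ, B.rank = m ∧ B.mulVec x = 0 ∧
      ∀ v ∈ T, y ⬝ᵥ B.mulVec v = 0 := by
  obtain ⟨φ, hφ, hφT⟩ := Submodule.exists_le_ker_of_lt_top T (lt_top_iff_ne_top.2 hT)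
  have hφx : φ ∈ (ℂ ∙ x).dualAnnihilator := by
    rw [Submodule.mem_dualAnnihilator]
    intro v hv
    exact hφT (Submodule.span_singleton_le_iff_mem _ _ |>.2 hxT hv)
  have hdim : Module.finrank ℂ (Fin m → ℂ) ≤ Module.finrank ℂ (ℂ ∙ x).dualAnnihilator := by
    have h := Subspace.finrank_add_finrank_dualAnnihilator_eq (ℂ ∙ x)
    rw [finrank_span_singleton hx, Module.finrank_fin_fun] at h
    rw [Module.finrank_fin_fun]
    omega
  -- Ψ is to be z ↦ zᵀB. Injectivity gives full rank, values in the annihilator of x give Bx = 0,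
  -- and Ψ(y) = φ gives the condition on T. The annihilator has dimension N - 1, hence the bound m +
  -- 1 ≤ N.
  obtain ⟨Ψ, hΨ, hΨy⟩ := exists_injective_linearMap_apply_eq hdim hy
    (w := (⟨φ, hφx⟩ : (ℂ ∙ x).dualAnnihilator)) (fun h => hφ (congrArg Subtype.val h))
  let B : Matrix (Fin m) (Fin N) ℂ := fun a j => (Ψ (Pi.single a 1)).1 (Pi.single j 1)
  have hB : ∀ (z : Fin m → ℂ) (v : Fin N → ℂ), z ⬝ᵥ B.mulVec v = (Ψ z).1 v := by
    intro z v
    have hBv : ∀ a, B.mulVec v a = (Ψ (Pi.single a 1)).1 v := by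
      intro a
      rw [linearMap_apply_eq_sum (Ψ (Pi.single a 1)).1 v]
      simp only [Matrix.mulVec, dotProduct, B, smul_eq_mul, mul_comm]
    rw [linearMap_apply_eq_sum Ψ z]
    simp only [dotProduct, hBv, Submodule.coe_sum, Submodule.coe_smul, LinearMap.sum_apply,
      LinearMap.smul_apply, smul_eq_mul]
  refine ⟨B, ?_, ?_, fun v hv => ?_⟩
  · have hli : LinearIndependent ℂ B.row := by
      rw [← Matrix.vecMul_injective_iff]
      refine (injective_iff_map_eq_zero B.vecMulLinear).2 fun z hz => hΨ ?_
      rw [map_zero]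
      refine Subtype.ext (LinearMap.ext fun v => ?_)
      rw [← hB, Matrix.dotProduct_mulVec, show Matrix.vecMul z B = 0 from hz, zero_dotProduct]
      rfl
    rw [hli.rank_matrix, Fintype.card_fin]
  · ext a
    have := (Submodule.mem_dualAnnihilator _).1 (Ψ (Pi.single a 1)).2 x
      (Submodule.mem_span_singleton_self x)
    rw [← hB, single_dotProduct, one_mul] at this
    exact this
  · rw [hB, hΨy]
    exact hφT hv

/-- The restriction of a matrix to a subspace `T` fails to be surjective if and only if the
intersection of the kernel with `T` is larger than expected. -/
theorem exists_forall_dotProduct_eq_zero_iff (A : Matrix (Fin m) (Fin N) ℂ)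
    (T : Submodule ℂ (Fin N → ℂ)) :
    (∃ y : Fin m → ℂ, y ≠ 0 ∧ ∀ v ∈ T, y ⬝ᵥ A.mulVec v = 0) ↔
      Module.finrank ℂ T <
        m + Module.finrank ℂ ↥(LinearMap.ker A.mulVecLin ⊓ T) := by
  have hrank := LinearMap.finrank_range_add_finrank_ker (A.mulVecLin.domRestrict T)
  have hker : Module.finrank ℂ (LinearMap.ker (A.mulVecLin.domRestrict T)) =
      Module.finrank ℂ ↥(LinearMap.ker A.mulVecLin ⊓ T) := by
    rw [LinearMap.ker_domRestrict, inf_comm, ← Submodule.map_comap_subtype,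
      Submodule.finrank_map_subtype_eq]
  have hlt : Module.finrank ℂ T < m + Module.finrank ℂ ↥(LinearMap.ker A.mulVecLin ⊓ T) ↔
      LinearMap.range (A.mulVecLin.domRestrict T) < ⊤ := by
    have hm := Module.finrank_fin_fun ℂ (n := m)
    refine ⟨fun h => lt_top_iff_ne_top.2 fun htop => ?_, fun h => ?_⟩
    · rw [htop, finrank_top] at hrank
      omega
    · have := Submodule.finrank_lt h.ne
      omega
  rw [hlt]
  constructor
  · rintro ⟨y, hy, h⟩
    refine lt_top_iff_ne_top.2 fun htop => hy ?_
    refine dotProduct_eq_zero _ fun w => ?_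
    obtain ⟨v, rfl⟩ := LinearMap.range_eq_top.1 htop w
    exact h v v.2
  · intro h
    obtain ⟨φ, hφ, hφA⟩ := Submodule.exists_le_ker_of_lt_top _ h
    have hdot : ∀ w, (fun a => φ (Pi.single a 1)) ⬝ᵥ w = φ w := by
      intro w
      rw [linearMap_apply_eq_sum φ w]
      exact Finset.sum_congr rfl fun a _ => mul_comm _ _
    refine ⟨fun a => φ (Pi.single a 1), fun h0 => hφ (LinearMap.ext fun w => ?_), fun v hv => ?_⟩
    · rw [← hdot, h0, zero_dotProduct]
      rfl
    · rw [hdot]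
      exact hφA ⟨⟨v, hv⟩, rfl⟩

theorem sum_mul_vecMulVec (A : Matrix (Fin m) (Fin N) ℂ) (y : Fin m → ℂ) (v : Fin N → ℂ) :
    ∑ p : Fin m × Fin N, A p.1 p.2 * Matrix.vecMulVec y v p.1 p.2 = y ⬝ᵥ A.mulVec v := by
  simp only [Fintype.sum_prod_type, dotProduct, Matrix.mulVec, Finset.mul_sum,
    Matrix.vecMulVec_apply]
  exact Finset.sum_congr rfl fun a _ => Finset.sum_congr rfl fun j _ => by ring

end LinearAlgebra

/-! ### Tangent hyperplanes and the coisotropic condition -/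

section Incidence

variable {m N k : ℕ} {X : Set (ℙ ℂ (Fin N → ℂ))}

/-- The matrices `A` that belong to hyperplanes tangent to `ℙ^m × X`. -/
theorem mk_mem_dualStar_segreProduct_iff (hX : IsIrreducibleVariety (coordBasis N) X)
    (hk : HasDim (coordBasis N) X k) {A : Matrix (Fin (m + 1)) (Fin N) ℂ} (hA : A ≠ 0) :
    Projectivization.mk ℂ A hA ∈ dualStar (matBasis (m + 1) N)
      {H | ∃ x ∈ Reg (matBasis (m + 1) N) (segreProduct Set.univ X),
        tangentSpace (matBasis (m + 1) N) (segreProduct Set.univ X) x ≤ LinearMap.ker H.rep} ↔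
      ∃ (x : Fin N → ℂ) (hx : x ≠ 0), Projectivization.mk ℂ x hx ∈ Reg (coordBasis N) X ∧
        A.mulVec x = 0 ∧ ∃ y : Fin (m + 1) → ℂ, y ≠ 0 ∧
        ∀ v ∈ tangentSpace (coordBasis N) X (Projectivization.mk ℂ x hx),
          y ⬝ᵥ A.mulVec v = 0 := by
  rw [mk_mem_dualStar_iff]
  simp only [matBasis_equivFun]
  constructor
  · rintro ⟨P, hP, h⟩
    obtain ⟨y, x, hy, hx, hxX, rfl⟩ := (mem_Reg_segreProduct_iff hX hk).1 hP
    refine ⟨x, hx, hxX, dotProduct_eq_zero _ fun z => ?_, y, hy, fun v hv => ?_⟩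
    · have := h _ (vecMulVec_mem_tangentSpace_left hy hx hxX.1 z)
      rwa [sum_mul_vecMulVec, dotProduct_comm] at this
    · have := h _ (vecMulVec_mem_tangentSpace_right hy hx hv)
      rwa [sum_mul_vecMulVec] at this
  · rintro ⟨x, hx, hxX, hAx, y, hy, h⟩
    refine ⟨_, (mem_Reg_segreProduct_iff hX hk).2 ⟨y, x, hy, hx, hxX, rfl⟩, fun M hM => ?_⟩
    obtain ⟨z, v, hv, rfl⟩ := (mem_tangentSpace_segreProduct hy hx hxX.1).1 hM
    simp only [Matrix.add_apply, mul_add, Finset.sum_add_distrib, sum_mul_vecMulVec, hAx,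
      dotProduct_zero, h v hv, add_zero]

/-- At a smooth point the expected dimension of the intersection is (k + 1) - (k - i + 1) = i, so
one more than expected is exactly the bound i + 1. -/
theorem stiefelKer_mem_iff {i : ℕ} (hi : i ≤ k) (hk : HasDim (coordBasis N) X k)
    (A : Stiefel (k - i + 1) N) :
    (∃ x ∈ Reg (coordBasis N) X, x.submodule ≤ (stiefelKer A).1 ∧
      i + 1 ≤ Module.finrank ℂ ↥((stiefelKer A).1 ⊓ tangentSpace (coordBasis N) X x)) ↔
      ∃ (x : Fin N → ℂ) (hx : x ≠ 0), Projectivization.mk ℂ x hx ∈ Reg (coordBasis N) X ∧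
        A.1.mulVec x = 0 ∧ ∃ y : Fin (k - i + 1) → ℂ, y ≠ 0 ∧
        ∀ v ∈ tangentSpace (coordBasis N) X (Projectivization.mk ℂ x hx),
          y ⬝ᵥ A.1.mulVec v = 0 := by
  simp only [exists_forall_dotProduct_eq_zero_iff]
  have key : ∀ (x : Fin N → ℂ) (hx : x ≠ 0),
      ((Projectivization.mk ℂ x hx).submodule ≤ (stiefelKer A).1 ↔ A.1.mulVec x = 0) := by
    intro x hx
    rw [Projectivization.submodule_mk, Submodule.span_singleton_le_iff_mem]
    rfl
  constructor
  · rintro ⟨P, hP, hPA, hdim⟩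
    induction P using Projectivization.ind with
    | h x hx =>
      refine ⟨x, hx, hP, (key x hx).1 hPA, ?_⟩
      rw [((mem_Reg_iff hk).1 hP).2]
      change _ < _ + Module.finrank ℂ ↥((stiefelKer A).1 ⊓ _)
      omega
  · rintro ⟨x, hx, hP, hAx, hdim⟩
    refine ⟨_, hP, (key x hx).2 hAx, ?_⟩
    rw [((mem_Reg_iff hk).1 hP).2] at hdim
    change _ < _ + Module.finrank ℂ ↥((stiefelKer A).1 ⊓ _) at hdim
    omega

/-- A proper irreducible subvariety of `ℙ^n` has dimension less than `n`. -/
theorem HasDim.lt_of_ne_univ {n : ℕ} {X : Set (ℙ ℂ (Fin (n + 1) → ℂ))}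
    (hX : IsIrreducibleVariety (coordBasis (n + 1)) X) (hk : HasDim (coordBasis (n + 1)) X k)
    (hne : X ≠ Set.univ) : k < n := by
  obtain ⟨f, hf, hf0⟩ : ∃ f ∈ vanishingIdeal (coordBasis (n + 1)) X, f ≠ 0 := by
    by_contra! hcon
    refine hne (Set.eq_univ_of_forall fun p => ?_)
    rw [← hX.isClosed]
    intro f hf v hv _
    rw [hcon f hf, map_zero]
  -- Dividing by an ideal that contains a non-zero-divisor lowers the dimension by at least one.
  have h := ringKrullDim_succ_le_of_surjective
    (Ideal.Quotient.mk (vanishingIdeal (coordBasis (n + 1)) X)) Ideal.Quotient.mk_surjective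
    (mem_nonZeroDivisors_of_ne_zero hf0) (Ideal.Quotient.eq_zero_iff_mem.2 hf)
  rw [show ringKrullDim (MvPolynomial (Fin (n + 1)) ℂ ⧸ vanishingIdeal (coordBasis (n + 1)) X) = _
    from hk, MvPolynomial.ringKrullDim_of_isNoetherianRing, ringKrullDim_eq_zero_of_field,
    Nat.card_eq_fintype_card, Fintype.card_fin, zero_add] at h
  have h' : k + 1 + 1 ≤ n + 1 := by exact_mod_cast h
  omega

/-- A polynomial that vanishes on the matrices of full rank in a linear space of matrices vanishes
on the whole space, if this contains a matrix of full rank. -/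
theorem eval_eq_zero_of_forall_rank_eq {f : MvPolynomial (Fin m × Fin N) ℂ}
    {W : Submodule ℂ (Matrix (Fin m) (Fin N) ℂ)}
    (hf : ∀ B ∈ W, B.rank = m → MvPolynomial.eval (fun p => B p.1 p.2) f = 0)
    {B : Matrix (Fin m) (Fin N) ℂ} (hB : B ∈ W) (hrank : B.rank = m)
    {A : Matrix (Fin m) (Fin N) ℂ} (hA : A ∈ W) :
    MvPolynomial.eval (fun p => A p.1 p.2) f = 0 := by
  obtain ⟨s, hs⟩ := exists_minor_ne_zero hrank
  let g : MvPolynomial (Fin m × Fin N) ℂ :=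
    (Matrix.of fun a c : Fin m => (MvPolynomial.X (a, s c) : MvPolynomial _ ℂ)).det
  have hg : ∀ M : Matrix (Fin m) (Fin N) ℂ,
      MvPolynomial.eval (fun p => M p.1 p.2) g = (M.submatrix id s).det := by
    intro M
    rw [RingHom.map_det]
    congr 1
    ext a c
    simp
  have hline : ∀ t : ℂ, (fun p : Fin m × Fin N => A p.1 p.2) +
      t • (fun p : Fin m × Fin N => (B - A) p.1 p.2) = fun p => (A + t • (B - A)) p.1 p.2 := by
    intro t
    ext p
    simp
  -- On the line from A (t = 0) to B (t = 1), which stays in W, the minor g is not identically zero,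
  -- and wherever it is non-zero the rank is full.
  have := eval_eq_zero_of_line (u := fun p : Fin m × Fin N => A p.1 p.2)
    (v := fun p => (B - A) p.1 p.2) (f := f) (g := g) (fun t ht => ?_) (t₀ := 1) ?_ 0
  · simpa using this
  · rw [hline] at ht ⊢
    rw [hg] at ht
    exact hf _ (W.add_mem hA (W.smul_mem t (W.sub_mem hB hA)))
      (rank_eq_of_det_submatrix_ne_zero ht)
  · rw [hline, hg]
    simpa using hs

/-- The linear space of the matrices that map `x` to zero and `T` to the orthogonal complement
of `y`. -/
def tangentMatrices (x : Fin N → ℂ) (T : Submodule ℂ (Fin N → ℂ)) (y : Fin m → ℂ) :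
    Submodule ℂ (Matrix (Fin m) (Fin N) ℂ) where
  carrier := {A | A.mulVec x = 0 ∧ ∀ v ∈ T, y ⬝ᵥ A.mulVec v = 0}
  zero_mem' := by simp
  add_mem' := by
    rintro A B ⟨hA, hA'⟩ ⟨hB, hB'⟩
    refine ⟨by rw [Matrix.add_mulVec, hA, hB, add_zero], fun v hv => ?_⟩
    rw [Matrix.add_mulVec, dotProduct_add, hA' v hv, hB' v hv, add_zero]
  smul_mem' := by
    rintro c A ⟨hA, hA'⟩
    refine ⟨by rw [Matrix.smul_mulVec, hA, smul_zero], fun v hv => ?_⟩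
    rw [Matrix.smul_mulVec, dotProduct_smul, hA' v hv, smul_zero]

end Incidence

end CayleyTrick

/-! ### The Cayley trick: equality of the vanishing ideals -/

theorem mainTheorem5 (n k i : ℕ) (X : Set (ℙ ℂ (Fin (n + 1) → ℂ)))
    (hX : CayleyTrick.IsIrreducibleVariety (CayleyTrick.coordBasis (n + 1)) X)
    (hk : CayleyTrick.HasDim (CayleyTrick.coordBasis (n + 1)) X k)
    (hi : i ≤ k)
    (hproper : X ≠ Set.univ ∨ i = k) :
    CayleyTrick.zariskiClosure (CayleyTrick.matBasis (k - i + 1) (n + 1))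
        (CayleyTrick.matrixPoints (CayleyTrick.stiefelKer ⁻¹' CayleyTrick.CH X k i)) =
      CayleyTrick.dualStar (CayleyTrick.matBasis (k - i + 1) (n + 1))
        (CayleyTrick.dualVariety (CayleyTrick.matBasis (k - i + 1) (n + 1))
          (CayleyTrick.segreProduct
            (Set.univ : Set (ℙ ℂ (Fin (k - i + 1) → ℂ))) X)) := by
  rw [CayleyTrick.dualVariety, CayleyTrick.dualStar_zariskiClosure, CayleyTrick.CH]
  refine CayleyTrick.zariskiClosure_congr
    ((CayleyTrick.vanishingIdeal_matrixPoints_grClosure _).trans ?_)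
  ext f
  rw [CayleyTrick.mem_vanishingIdeal_matrixPoints]
  simp only [Set.mem_ofPred_eq, CayleyTrick.stiefelKer_mem_iff hi hk]
  constructor
  · rintro hf A hA hAmem
    rw [CayleyTrick.matBasis_equivFun]
    obtain ⟨x, hx, hxX, hAx, y, hy, hAy⟩ :=
      (CayleyTrick.mk_mem_dualStar_segreProduct_iff hX hk hA).1 hAmem
    obtain ⟨B, hBrank, hB⟩ : ∃ B : Matrix (Fin (k - i + 1)) (Fin (n + 1)) ℂ,
        B.rank = k - i + 1 ∧ B ∈ CayleyTrick.tangentMatrices x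
          (CayleyTrick.tangentSpace (CayleyTrick.coordBasis (n + 1)) X
            (Projectivization.mk ℂ x hx)) y := by
      rcases hproper with hne | rfl
      -- Here k < n, so the tangent space, of linear dimension k + 1, is proper in ℂ^(n+1).
      · have hkn := hk.lt_of_ne_univ hX hne
        have hfin := ((CayleyTrick.mem_Reg_iff hk).1 hxX).2
        refine CayleyTrick.exists_rank_eq_of_ne_top (by omega) (fun htop => ?_) hx
          (CayleyTrick.self_mem_tangentSpace hx hxX.1) hy
        rw [htop, finrank_top, Module.finrank_fin_fun] at hfin
        omega
      -- For i = k there is a single row, so the non-zero matrix A itself has full rank.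
      · refine ⟨A, le_antisymm A.rank_le_height ?_, hAx, hAy⟩
        have : A.rank ≠ 0 := fun h => hA <| by
          rw [Matrix.rank, Submodule.finrank_eq_zero, LinearMap.range_eq_bot] at h
          refine (Matrix.toLin' (R := ℂ)).injective ?_
          rw [map_zero]
          exact h
        omega
    -- A may have lower rank, but it shares x and y with the matrices of full rank on which f is
    -- known to vanish.
    exact CayleyTrick.eval_eq_zero_of_forall_rank_eq (W := CayleyTrick.tangentMatrices x _ y)
      (fun C ⟨hCx, hCy⟩ hCrank => hf ⟨C, hCrank⟩ ⟨x, hx, hxX, hCx, y, hy, hCy⟩)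
      hB hBrank ⟨hAx, hAy⟩
  · intro hf A hA
    have := hf A.1 A.ne_zero
      ((CayleyTrick.mk_mem_dualStar_segreProduct_iff hX hk A.ne_zero).2 hA)
    rwa [CayleyTrick.matBasis_equivFun] at this
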